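/- **Proposition 2.4.** Let $k$ be an algebraically closed field of characteristic $p\ge 0$, let $M$ be a lattice (a free abelian group of finite rank) and put $M_{\mathbb R}=M\otimes_{\mathbb Z}\mathbb R$. Let $S\subseteq M$ be a finitely generated semigroup with $0\in S$ and $S-S=M$, let $\sigma_S\subseteq M_{\mathbb R}$ be the cone generated by $S$, let $\bar S=\bigcup_{n\ge 1}\{m\in M : nm\in S\}$, and let $X=\operatorname{Spec} k[S]$. Write $\sigma\prec\sigma_S$ if $\sigma$ is a face of $\sigma_S$ ($\sigma_S$ itself included), $A-A=\{a-b : a,b\in A\}$ for $A\subseteq M$, and $\operatorname{relint}\sigma$ for the relative interior of $\sigma$. Set $$S^{wn}=\bigsqcup_{\sigma\prec\sigma_S}\ \bigcup_{e\ge 0}\ \{m\in\bar S : p^e m\in (S\cap\sigma-S\cap\sigma)\cap\operatorname{relint}\sigma\},$$ where $p^e$ is understood to be $1$ if $p=0$. Then this union over the faces is indeed disjoint, $S^{wn}$ is a semigroup containing $S$ (and $0$), and the morphism $\operatorname{Spec} k[S^{wn}]\to\operatorname{Spec} k[S]$ induced by the inclusion $S\subseteq S^{wn}$ is the weak normalization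 of $X$. Here the weak normalization of a variety $X$ (varieties are reduced schemes of finite type over $k$) is a birational universal homeomorphism $f:Y\to X$ from a variety $Y$ which is maximal with this property: for every birational universal homeomorphism $g:Z\to X$ from a variety $Z$ there is a unique morphism $h:Y\to Z$ with $g\circ h=f$. -/

import Mathlib

universe u v

open scoped Pointwise TensorProduct

namespace WeakNormalization

section Schemes

open CategoryTheory AlgebraicGeometry

/-- A morphism of schemes is birational if it restricts to an isomorphism from a dense open
subscheme of the source onto a dense open subscheme of the target. -/
def IsBirational {Y X : Scheme.{u}} (f : Y ⟶ X) : Prop :=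
  ∃ (U : X.Opens) (V : Y.Opens) (e : V ≤ f ⁻¹ᵁ U),
    Dense (U : Set X) ∧ Dense (V : Set Y) ∧ IsIso (f.resLE U V e)

/-- A universal homeomorphism: every base change is a homeomorphism on underlying spaces. -/
def IsUniversalHomeo {Y X : Scheme.{u}} (f : Y ⟶ X) : Prop :=
  MorphismProperty.universally (topologically (IsHomeomorph ·)) f

/-- A birational universal homeomorphism onto `X` from a variety. If `X` is of finite type over a
field `k`, then `f` is of finite type if and only if `Y` is of finite type over `k`, so the first
three fields say that `Y` is a variety (a reduced scheme of finite type over `k`). -/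
structure IsBirationalUniversalHomeo {Y X : Scheme.{u}} (f : Y ⟶ X) : Prop where
  isReduced : IsReduced Y
  locallyOfFiniteType : LocallyOfFiniteType f
  quasiCompact : QuasiCompact f
  isUniversalHomeo : IsUniversalHomeo f
  isBirational : IsBirational f

/-- `f : Y ⟶ X` is the weak normalization of the variety `X`: it is a birational universal
homeomorphism, and it is maximal as such, that is, it factors uniquely through every other one. -/
def IsWeakNormalization {Y X : Scheme.{u}} (f : Y ⟶ X) : Prop :=
  IsBirationalUniversalHomeo f ∧
    ∀ (Z : Scheme.{u}) (g : Z ⟶ X), IsBirationalUniversalHomeo g → ∃! h : Y ⟶ Z, h ≫ g = f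

end Schemes

section Cones

/-- The relative interior of a subset of a finite-dimensional real vector space `V`: its interior
in its affine span. The module topology is the usual topology of `V`. -/
def relint {V : Type v} [AddCommGroup V] [Module ℝ V] (s : Set V) : Set V :=
  letI : TopologicalSpace V := moduleTopology ℝ V
  intrinsicInterior ℝ s

variable {M : Type v} [AddCommGroup M]

/-- The canonical map from a lattice `M` to the real vector space `ℝ ⊗ M`. -/
def toReal : M →+ ℝ ⊗[ℤ] M :=
  (TensorProduct.mk ℤ ℝ M 1).toAddMonoidHom

/-- The cone in `ℝ ⊗ M` generated by a semigroup `S` in `M`. -/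
def cone (S : AddSubmonoid M) : PointedCone ℝ (ℝ ⊗[ℤ] M) :=
  PointedCone.hull ℝ (toReal '' (S : Set M))

/-- The part `S ∩ σ` of `S` in a cone `σ`. -/
def part (S : AddSubmonoid M) (σ : PointedCone ℝ (ℝ ⊗[ℤ] M)) : Set M :=
  {m | m ∈ S ∧ toReal m ∈ σ}

/-- The saturation of `S` in `M`: the elements of `M` with a positive multiple in `S`. -/
def saturation (S : AddSubmonoid M) : Set M :=
  {m | ∃ n : ℕ, 1 ≤ n ∧ n • m ∈ S}

/-- The number `p ^ e`, with the convention that it is `1` if `p = 0`. -/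
def charPow (p e : ℕ) : ℕ := if p = 0 then 1 else p ^ e

/-- The elements `m` of the saturation of `S` such that, for some `e ≥ 0`, `p ^ e • m` lies in
`(S ∩ σ - S ∩ σ) ∩ relint σ`. -/
def wnPiece (p : ℕ) (S : AddSubmonoid M) (σ : PointedCone ℝ (ℝ ⊗[ℤ] M)) : Set M :=
  ⋃ e : ℕ, {m | m ∈ saturation S ∧ charPow p e • m ∈ part S σ - part S σ ∧
    toReal (charPow p e • m) ∈ relint (σ : Set (ℝ ⊗[ℤ] M))}

/-- The union of the pieces over all faces of the cone generated by `S`. -/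
def wn (p : ℕ) (S : AddSubmonoid M) : Set M :=
  ⋃ σ ∈ {σ : PointedCone ℝ (ℝ ⊗[ℤ] M) | σ.IsFaceOf (cone S)}, wnPiece p S σ

end Cones

section SemigroupRings

open CategoryTheory AlgebraicGeometry

/-- The morphism `Spec k[T] ⟶ Spec k[S]` induced by an inclusion of semigroups `S ≤ T`. -/
noncomputable def specMap (k : Type u) [Field k] {M : Type v} [AddCommGroup M]
    {S T : AddSubmonoid M} (h : S ≤ T) :
    Spec (CommRingCat.of (AddMonoidAlgebra k T)) ⟶ Spec (CommRingCat.of (AddMonoidAlgebra k S)) :=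
  Spec.map (CommRingCat.ofHom
    (AddMonoidAlgebra.mapDomainAlgHom k k (AddSubmonoid.inclusion h)).toRingHom)

end SemigroupRings

end WeakNormalization

/-! Every point of a cone lies in the relative interior of exactly one face, its minimal face. This
gives disjointness, and closure under addition follows because the minimal face of `a + b` contains
those of `a` and `b`.

Let `T` be the semigroup `wn p S`. It lies in the saturation of `S`, a finite union of translates of
`S`, so `k[T]` is finite over `k[S]`; both rings become `k[M]` after inverting one monomial, which
gives birationality. For universal injectivity, homomorphisms from `k[T]` to a field must be
determined on `k[S]` (`ringHom_eq_of_comp_incl_eq`). If `t` lies in the piece of `σ` and its image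
is nonzero, then the images of all elements of `S ∩ σ` are nonzero, so writing `p ^ e • t` as a
difference of such elements determines the `p ^ e`-th power of the image, and Frobenius is injective
on fields.

For maximality, a birational universal homeomorphism to `Spec k[S]` is finite, hence given by an
integral `k[S]`-algebra `C`, which maps to the fraction field of `k[M]` by birationality. The image
consists of elements integral over `k[S]`, so it lies in the algebra of the saturation
(`exists_algebraMap_emb_eq_of_isIntegralElem`). If a monomial `m` outside `T` occurred in it, let
`F` be the minimal face of `m`. Some character of `M` is trivial on the group of `S ∩ F` but not at
`m`. Killing the monomials outside `F` and twisting the others by this character, or not twisting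
them, gives two homomorphisms that agree on `k[S]` and differ on `C`, contradicting universal
injectivity (`mem_wn_of_forall_ringHom_eq`). -/

namespace WeakNormalization

/-! ### Relative interiors and minimal faces of cones -/

section RelativeInterior

variable {V : Type v} [AddCommGroup V] [Module ℝ V]

lemma relint_subset (s : Set V) : relint s ⊆ s :=
  @intrinsicInterior_subset ℝ V V _ _ _ (moduleTopology ℝ V) _ s

lemma relint_nonempty [Module.Finite ℝ V] {s : Set V} (hs : Convex ℝ s) (hne : s.Nonempty) :
    (relint s).Nonempty := by
  let : TopologicalSpace V := moduleTopology ℝ V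
  have : IsModuleTopology ℝ V := ⟨rfl⟩
  have : ContinuousAdd V := IsModuleTopology.toContinuousAdd ℝ V
  let e : V ≃ₗ[ℝ] (Fin (Module.finrank ℝ V) → ℝ) := (Module.finBasis ℝ V).equivFun
  let e' : V ≃L[ℝ] (Fin (Module.finrank ℝ V) → ℝ) :=
    { e with
      continuous_toFun := IsModuleTopology.continuous_of_linearMap e.toLinearMap
      continuous_invFun := IsModuleTopology.continuous_of_linearMap e.symm.toLinearMap }
  have h : (intrinsicInterior ℝ (e' '' s)).Nonempty :=
    Set.Nonempty.intrinsicInterior (hs.linear_image e.toLinearMap) (hne.image _)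
  have h2 := e'.toContinuousAffineEquiv.intrinsicInterior_image s
  rw [ContinuousLinearEquiv.coe_toContinuousAffineEquiv] at h2
  rw [h2, Set.image_nonempty] at h
  exact h

/-- The line through `x` in direction `y - z` stays in the affine span of `s`, in which `x` is an
interior point of `s`. -/
lemma exists_add_smul_sub_mem_of_mem_relint {s : Set V} {x y z : V} (hx : x ∈ relint s)
    (hy : y ∈ s) (hz : z ∈ s) : ∃ ε : ℝ, 0 < ε ∧ ε • (y - z) + x ∈ s := by
  let : TopologicalSpace V := moduleTopology ℝ V
  have : IsModuleTopology ℝ V := ⟨rfl⟩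
  have : ContinuousAdd V := IsModuleTopology.toContinuousAdd ℝ V
  obtain ⟨⟨x, hxs⟩, hxi, rfl⟩ := mem_intrinsicInterior.1 hx
  have hmem (t : ℝ) : t • (y - z) + x ∈ affineSpan ℝ s := by
    simpa using AffineSubspace.smul_vsub_vadd_mem _ t (subset_affineSpan ℝ s hy)
      (subset_affineSpan ℝ s hz) hxs
  let φ : ℝ → affineSpan ℝ s := fun t => ⟨t • (y - z) + x, hmem t⟩
  have hφ : Continuous φ := by
    apply Continuous.subtype_mk
    fun_prop
  have h0 : φ 0 = ⟨x, hxs⟩ := by simp [φ]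
  have hev : ∀ᶠ t in nhds (0 : ℝ), φ t ∈ interior ((↑) ⁻¹' s : Set (affineSpan ℝ s)) :=
    hφ.continuousAt.eventually_mem (isOpen_interior.mem_nhds (h0 ▸ hxi))
  have hev' : ∀ᶠ t in nhdsWithin (0 : ℝ) (Set.Ioi 0),
      φ t ∈ interior ((↑) ⁻¹' s : Set (affineSpan ℝ s)) := hev.filter_mono nhdsWithin_le_nhds
  obtain ⟨t, ht, ht0⟩ := (hev'.and self_mem_nhdsWithin).exists
  exact ⟨t, ht0, interior_subset (s := ((↑) ⁻¹' s : Set (affineSpan ℝ s))) ht⟩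

lemma exists_sub_smul_mem_of_mem_relint {C : PointedCone ℝ V} {x y : V}
    (hx : x ∈ relint (C : Set V)) (hy : y ∈ C) : ∃ ε : ℝ, 0 < ε ∧ x - ε • y ∈ C := by
  obtain ⟨ε, hε, h⟩ := exists_add_smul_sub_mem_of_mem_relint hx C.zero_mem hy
  refine ⟨ε, hε, ?_⟩
  rwa [show x - ε • y = ε • (0 - y) + x by module]

/-- The affine self-map `z ↦ a • z + w` of a cone preserves relative interiors, if `w ∈ C`. -/
lemma smul_add_mem_relint {C : PointedCone ℝ V} {z w : V} {a : ℝ} (ha : 0 < a)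
    (hz : z ∈ relint (C : Set V)) (hw : w ∈ C) : a • z + w ∈ relint (C : Set V) := by
  let : TopologicalSpace V := moduleTopology ℝ V
  have : IsModuleTopology ℝ V := ⟨rfl⟩
  have : ContinuousAdd V := IsModuleTopology.toContinuousAdd ℝ V
  have : IsTopologicalAddGroup V := IsModuleTopology.topologicalAddGroup ℝ V
  obtain ⟨⟨z, hzs⟩, hzi, rfl⟩ := mem_intrinsicInterior.1 hz
  have h0 : (0 : V) ∈ affineSpan ℝ (C : Set V) := subset_affineSpan ℝ _ C.zero_mem
  have hw' : w ∈ affineSpan ℝ (C : Set V) := subset_affineSpan ℝ _ hw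
  have hadd {x y : V} (t : ℝ) (hx : x ∈ affineSpan ℝ (C : Set V))
      (hy : y ∈ affineSpan ℝ (C : Set V)) : t • x + y ∈ affineSpan ℝ (C : Set V) := by
    simpa using AffineSubspace.smul_vsub_vadd_mem _ t hx h0 hy
  have hmem (v : V) (hv : v ∈ affineSpan ℝ (C : Set V)) :
      a⁻¹ • ((-1 : ℝ) • w + v) ∈ affineSpan ℝ (C : Set V) := by
    simpa using hadd a⁻¹ (hadd (-1) hw' hv) h0
  let φ : affineSpan ℝ (C : Set V) → affineSpan ℝ (C : Set V) :=
    fun v => ⟨a⁻¹ • ((-1 : ℝ) • w + v), hmem v v.2⟩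
  have hφ : Continuous φ := by
    apply Continuous.subtype_mk
    fun_prop
  refine mem_intrinsicInterior.2 ⟨⟨a • z + w, hadd a hzs hw'⟩, ?_, rfl⟩
  refine mem_interior.2 ⟨φ ⁻¹' interior ((↑) ⁻¹' (C : Set V)), ?_, isOpen_interior.preimage hφ, ?_⟩
  · intro v hv
    have h1 : a⁻¹ • ((-1 : ℝ) • w + (v : V)) ∈ C :=
      interior_subset (s := ((↑) ⁻¹' (C : Set V) : Set (affineSpan ℝ (C : Set V)))) hv
    have h2 : a • (a⁻¹ • ((-1 : ℝ) • w + (v : V))) + w ∈ C := C.add_mem (C.smul_mem ha.le h1) hw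
    have : a • (a⁻¹ • ((-1 : ℝ) • w + (v : V))) + w = v := by
      rw [smul_inv_smul₀ ha.ne']; module
    rw [this] at h2
    exact h2
  · have : φ ⟨a • z + w, hadd a hzs hw'⟩ = ⟨z, hzs⟩ := by
      apply Subtype.ext
      change a⁻¹ • ((-1 : ℝ) • w + (a • z + w)) = z
      rw [show (-1 : ℝ) • w + (a • z + w) = a • z by module, inv_smul_smul₀ ha.ne']
    rw [Set.mem_preimage, this]
    exact hzi

/-- For `y` in `σ`, the point `x` is the sum of `ε • y` and `x - ε • y`, both in `C`; since the sum
lies in the face `F`, so does `y`. -/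
lemma _root_.PointedCone.IsFaceOf.le_of_mem_relint {C F σ : PointedCone ℝ V} (hF : F.IsFaceOf C)
    (hσ : σ ≤ C) {x : V} (hx : x ∈ relint (σ : Set V)) (hxF : x ∈ F) : σ ≤ F := by
  intro y hy
  obtain ⟨ε, hε, h⟩ := exists_sub_smul_mem_of_mem_relint hx hy
  refine hF.mem_of_smul_add_mem (a := ε) (hσ hy) (hσ h) hε ?_
  simpa using hxF

/-- The smallest face of a cone `C` containing a point `x` of `C`. -/
def minFace (C : PointedCone ℝ V) (x : V) : PointedCone ℝ V where
  carrier := {y | y ∈ C ∧ (x ∈ C → ∃ ε : ℝ, 0 < ε ∧ x - ε • y ∈ C)}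
  zero_mem' := ⟨C.zero_mem, fun hx => ⟨1, one_pos, by simpa using hx⟩⟩
  add_mem' := by
    rintro y z ⟨hy, hy'⟩ ⟨hz, hz'⟩
    refine ⟨C.add_mem hy hz, fun hx => ?_⟩
    obtain ⟨a, ha, hya⟩ := hy' hx
    obtain ⟨b, hb, hzb⟩ := hz' hx
    -- Average `x - a • y` and `x - b • z` with weights `b / (a + b)` and `a / (a + b)`, which makes
    -- the coefficients of `y` and `z` equal.
    refine ⟨a * b / (a + b), by positivity, ?_⟩
    have := C.add_mem (C.smul_mem (show 0 ≤ b / (a + b) by positivity) hya)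
      (C.smul_mem (show 0 ≤ a / (a + b) by positivity) hzb)
    convert this using 1
    have h1 : a / (a + b) = 1 - b / (a + b) := by field_simp; ring
    rw [show a * b / (a + b) = b / (a + b) * a by ring]
    have h2 : a / (a + b) * b = b / (a + b) * a := by ring
    calc x - (b / (a + b) * a) • (y + z)
        = (b / (a + b)) • x - (b / (a + b) * a) • y + ((1 - b / (a + b)) • x -
            (b / (a + b) * a) • z) := by module
      _ = _ := by rw [← h1, ← h2, smul_sub, smul_sub, smul_smul, smul_smul, h2]
  smul_mem' := by
    rintro ⟨c, hc⟩ y ⟨hy, hy'⟩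
    refine ⟨C.smul_mem hc hy, fun hx => ?_⟩
    obtain ⟨a, ha, hya⟩ := hy' hx
    rcases hc.eq_or_lt with rfl | hc
    · refine ⟨1, one_pos, ?_⟩
      convert hx using 1
      change x - (1 : ℝ) • (0 : ℝ) • y = x
      simp
    · refine ⟨a / c, by positivity, ?_⟩
      convert hya using 1
      change x - (a / c) • c • y = _
      rw [smul_smul, div_mul_cancel₀ _ hc.ne']

lemma minFace_isFaceOf (C : PointedCone ℝ V) (x : V) : (minFace C x).IsFaceOf C := by
  refine .of_mem_of_add_mem_left (fun y hy => hy.1) fun {y z} hy hz hyz => ⟨hy, fun hx => ?_⟩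
  obtain ⟨ε, hε, h⟩ := hyz.2 hx
  refine ⟨ε, hε, ?_⟩
  convert C.add_mem h (C.smul_mem hε.le hz) using 1
  module

/-- Take any relative interior point `z`. By minimality `x - ε • z` lies in the face, and the map `v
↦ ε • v + (x - ε • z)` carries `z` to `x`. -/
lemma self_mem_relint_minFace [Module.Finite ℝ V] {C : PointedCone ℝ V} {x : V} (hx : x ∈ C) :
    x ∈ relint (minFace C x : Set V) := by
  have hxF : x ∈ minFace C x := ⟨hx, fun _ => ⟨1, one_pos, by simp⟩⟩
  obtain ⟨z, hz⟩ := relint_nonempty (s := (minFace C x : Set V))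
    (PointedCone.convex _) ⟨0, (minFace C x).zero_mem⟩
  obtain ⟨hzC, h⟩ := relint_subset _ hz
  obtain ⟨ε, hε, hw⟩ := h hx
  have hwF : x - ε • z ∈ minFace C x := by
    refine (minFace_isFaceOf C x).mem_of_add_mem_left hw (C.smul_mem hε.le hzC) ?_
    simpa using hxF
  simpa using smul_add_mem_relint hε hz hwF

end RelativeInterior

/-! ### Farkas' lemma over the integers -/

section Farkas

variable {M : Type v} [AddCommGroup M]

/-- Induction on the number of generators. If a form separating `x` from the tail is negative on the
new generator `a`, project along `a` and apply the induction hypothesis to the projected tail. -/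
lemma exists_nsmul_mem_closure_or_exists_neg [Module.Free ℤ M] (n : ℕ) (l : List M)
    (hl : l.length = n) (x : M) :
    (∃ N : ℕ, 1 ≤ N ∧ N • x ∈ AddSubmonoid.closure {y | y ∈ l}) ∨
      ∃ f : M →+ ℤ, (∀ y ∈ l, 0 ≤ f y) ∧ f x < 0 := by
  induction n generalizing l x with
  | zero =>
    obtain rfl := List.length_eq_zero_iff.1 hl
    by_cases hx : x = 0
    · exact .inl ⟨1, le_rfl, by simp [hx]⟩
    · right
      let b := Module.Free.chooseBasis ℤ M
      have : b.repr x ≠ 0 := by simpa using hx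
      obtain ⟨i, hi⟩ := Finsupp.ne_iff.1 this
      rcases lt_or_gt_of_ne hi with h | h
      · exact ⟨(b.coord i).toAddMonoidHom, by simp, h⟩
      · exact ⟨-(b.coord i).toAddMonoidHom, by simp, by simpa using h⟩
  | succ n ih =>
    obtain _ | ⟨a, t⟩ := l
    · simp at hl
    have ht : t.length = n := by simpa using hl
    have hta : AddSubmonoid.closure {y | y ∈ t} ≤ AddSubmonoid.closure {y | y ∈ a :: t} :=
      AddSubmonoid.closure_mono fun y (hy : y ∈ t) => List.mem_cons_of_mem a hy
    rcases ih t ht x with ⟨N, hN, h⟩ | ⟨f, hf, hfx⟩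
    · exact .inl ⟨N, hN, hta h⟩
    rcases le_or_gt 0 (f a) with hfa | hfa
    · refine .inr ⟨f, fun y hy => ?_, hfx⟩
      rcases List.mem_cons.1 hy with rfl | hy
      exacts [hfa, hf y hy]
    obtain ⟨c, hc⟩ := Int.eq_ofNat_of_zero_le (neg_nonneg.2 hfa.le)
    have hc0 : 1 ≤ c := by omega
    -- With `c = -f a`, this is `c` times the projection along `a` to the kernel of `f`, without
    -- denominators.
    let g : M →+ M := c • AddMonoidHom.id M + ((AddMonoidHom.flip (smulAddHom ℤ M)) a).comp f
    have hg (v : M) : g v = c • v + f v • a := rfl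
    have hga : g a = 0 := by
      rw [hg, ← natCast_zsmul, ← add_smul, ← hc]; simp
    rcases ih (t.map g) (by simpa using ht) (g x) with ⟨N, hN, h⟩ | ⟨f', hf', hfx'⟩
    · left
      have : {y | y ∈ t.map g} = g '' {y | y ∈ t} := by ext; simp
      rw [this, ← AddMonoidHom.map_mclosure] at h
      obtain ⟨y, hy, hyx⟩ := h
      have hfy : 0 ≤ f y := by
        refine AddSubmonoid.closure_induction (fun z hz => hf z hz) (by simp)
          (fun z w _ _ hz hw => by rw [map_add]; exact add_nonneg hz hw) hy
      obtain ⟨d, hd⟩ := Int.eq_ofNat_of_zero_le (show 0 ≤ f y - N * f x by nlinarith)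
      refine ⟨N * c, Nat.mul_pos hN hc0, ?_⟩
      have : (N * c) • x = c • y + d • a := by
        have h1 : N • c • x + N • f x • a = c • y + f y • a := by
          rw [← smul_add, ← hg, ← hg]; exact hyx.symm
        have h2 : d • a = f y • a - N • f x • a := by
          rw [← natCast_zsmul, ← hd, sub_smul, mul_smul, natCast_zsmul]
        rw [h2, mul_smul, eq_sub_of_add_eq h1]
        abel
      rw [this]
      exact add_mem (nsmul_mem (hta hy) _)
        (nsmul_mem (AddSubmonoid.subset_closure (s := {y | y ∈ a :: t}) List.mem_cons_self) _)
    · refine .inr ⟨f'.comp g, fun y hy => ?_, hfx'⟩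
      rcases List.mem_cons.1 hy with rfl | hy
      · simp [hga]
      · exact hf' _ (List.mem_map_of_mem hy)

/-- Farkas' lemma for a finitely generated monoid in a lattice. -/
theorem mem_saturation_or_exists_neg [Module.Free ℤ M] {S : AddSubmonoid M} (hS : S.FG) (x : M) :
    x ∈ saturation S ∨ ∃ f : M →+ ℤ, (∀ y ∈ S, 0 ≤ f y) ∧ f x < 0 := by
  obtain ⟨A, rfl⟩ := hS
  rcases exists_nsmul_mem_closure_or_exists_neg _ A.toList rfl x with h | ⟨f, hf, hfx⟩
  · left
    rw [show {y | y ∈ A.toList} = (A : Set M) by ext; simp] at h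
    exact h
  · refine .inr ⟨f, fun y hy => ?_, hfx⟩
    exact AddSubmonoid.closure_induction (fun z hz => hf z (by simpa using hz)) (by simp)
      (fun z w _ _ hz hw => by rw [map_add]; exact add_nonneg hz hw) hy

end Farkas
end WeakNormalization

namespace WeakNormalization

/-! ### The pieces, their disjointness, and the semigroup they form -/

section Pieces

variable {M : Type v} [AddCommGroup M] {S : AddSubmonoid M}

lemma toReal_nsmul (n : ℕ) (m : M) : toReal (n • m) = (n : ℝ) • toReal m := by
  rw [map_nsmul, Nat.cast_smul_eq_nsmul]

lemma toReal_mem_cone {m : M} (hm : m ∈ S) : toReal m ∈ cone S :=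
  Submodule.subset_span ⟨m, hm, rfl⟩

lemma toReal_mem_cone_of_nsmul {C : PointedCone ℝ (ℝ ⊗[ℤ] M)} {n : ℕ} (hn : 1 ≤ n) {m : M}
    (h : toReal (n • m) ∈ C) : toReal m ∈ C := by
  have hn' : (0 : ℝ) < n := by exact_mod_cast hn
  have := C.smul_mem (inv_nonneg.2 hn'.le) h
  rwa [toReal_nsmul, inv_smul_smul₀ hn'.ne'] at this

lemma toReal_mem_cone_of_mem_saturation {m : M} (hm : m ∈ saturation S) : toReal m ∈ cone S := by
  obtain ⟨n, hn, h⟩ := hm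
  exact toReal_mem_cone_of_nsmul hn (toReal_mem_cone h)

/-- The lattice points of the cone generated by `S` are the elements of the saturation of `S`. -/
theorem toReal_mem_cone_iff [Module.Free ℤ M] (hS : S.FG) {m : M} :
    toReal m ∈ cone S ↔ m ∈ saturation S := by
  refine ⟨fun h => ?_, toReal_mem_cone_of_mem_saturation⟩
  refine (mem_saturation_or_exists_neg hS m).resolve_right ?_
  rintro ⟨f, hf, hfm⟩
  let g : (ℝ ⊗[ℤ] M) →ₗ[ℝ] ℝ :=
    LinearMap.liftBaseChange ℝ ((Algebra.linearMap ℤ ℝ).comp f.toIntLinearMap)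
  have hg (x : M) : g (toReal x) = f x := by
    simp [g, toReal]
  have : cone S ≤ PointedCone.comap g (PointedCone.positive ℝ ℝ) := by
    refine Submodule.span_le.2 ?_
    rintro _ ⟨s, hs, rfl⟩
    have : (0 : ℝ) ≤ g (toReal s) := by rw [hg]; exact_mod_cast hf s hs
    simpa using this
  have h2 : (0 : ℝ) ≤ g (toReal m) := by simpa using this h
  rw [hg] at h2
  exact absurd (by exact_mod_cast h2) (not_le.2 hfm)

lemma one_le_charPow {k : Type u} [Field k] (p : ℕ) [CharP k p] (e : ℕ) : 1 ≤ charPow p e := by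
  unfold charPow
  split_ifs with h
  · exact le_rfl
  · exact Nat.one_le_pow _ _ (Nat.pos_of_ne_zero h)

lemma charPow_add (p a b : ℕ) : charPow p (a + b) = charPow p a * charPow p b := by
  unfold charPow
  split_ifs <;> simp [pow_add]

lemma charPow_zero (p : ℕ) : charPow p 0 = 1 := by simp [charPow]

/-- The elements of the saturation of `S` form a semigroup. -/
def saturationSubmonoid (S : AddSubmonoid M) : AddSubmonoid M where
  carrier := saturation S
  zero_mem' := ⟨1, le_rfl, by simp⟩
  add_mem' := by
    rintro a b ⟨n, hn, ha⟩ ⟨l, hl, hb⟩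
    refine ⟨n * l, Nat.mul_pos hn hl, ?_⟩
    rw [smul_add, mul_comm n l, mul_smul, mul_comm l n, mul_smul n l]
    exact add_mem (nsmul_mem ha _) (nsmul_mem hb _)

/-- The group `S ∩ σ - S ∩ σ`. -/
def partGroup (S : AddSubmonoid M) (σ : PointedCone ℝ (ℝ ⊗[ℤ] M)) : AddSubgroup M where
  carrier := part S σ - part S σ
  zero_mem' := ⟨0, ⟨S.zero_mem, by simp⟩, 0, ⟨S.zero_mem, by simp⟩, by simp⟩
  add_mem' := by
    rintro _ _ ⟨a, ha, b, hb, rfl⟩ ⟨c, hc, d, hd, rfl⟩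
    refine ⟨a + c, ⟨add_mem ha.1 hc.1, ?_⟩, b + d, ⟨add_mem hb.1 hd.1, ?_⟩, ?_⟩
    · rw [map_add]; exact add_mem ha.2 hc.2
    · rw [map_add]; exact add_mem hb.2 hd.2
    · simp only; abel
  neg_mem' := by
    rintro _ ⟨a, ha, b, hb, rfl⟩
    exact ⟨b, hb, a, ha, by simp⟩

lemma mem_partGroup_of_mem {σ : PointedCone ℝ (ℝ ⊗[ℤ] M)} {m : M} (hm : m ∈ S)
    (hσ : toReal m ∈ σ) : m ∈ partGroup S σ :=
  ⟨m, ⟨hm, hσ⟩, 0, ⟨S.zero_mem, by simp⟩, by simp⟩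

lemma partGroup_mono {σ τ : PointedCone ℝ (ℝ ⊗[ℤ] M)} (h : σ ≤ τ) :
    partGroup S σ ≤ partGroup S τ := by
  rintro _ ⟨a, ha, b, hb, rfl⟩
  exact ⟨a, ⟨ha.1, h ha.2⟩, b, ⟨hb.1, h hb.2⟩, rfl⟩

lemma mem_wnPiece_iff {p : ℕ} {σ : PointedCone ℝ (ℝ ⊗[ℤ] M)} {m : M} :
    m ∈ wnPiece p S σ ↔ m ∈ saturation S ∧ ∃ e, charPow p e • m ∈ partGroup S σ ∧
      toReal (charPow p e • m) ∈ relint (σ : Set (ℝ ⊗[ℤ] M)) := by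
  simp only [wnPiece, Set.mem_iUnion]
  constructor
  · rintro ⟨e, h1, h2, h3⟩
    exact ⟨h1, e, h2, h3⟩
  · rintro ⟨h1, e, h2, h3⟩
    exact ⟨e, h1, h2, h3⟩

lemma mem_wn_iff {p : ℕ} {m : M} :
    m ∈ wn p S ↔ ∃ σ : PointedCone ℝ (ℝ ⊗[ℤ] M), σ.IsFaceOf (cone S) ∧ m ∈ wnPiece p S σ := by
  simp [wn]

lemma toReal_mem_of_mem_wnPiece {k : Type u} [Field k] {p : ℕ} [CharP k p]
    {σ : PointedCone ℝ (ℝ ⊗[ℤ] M)} {m : M} (hm : m ∈ wnPiece p S σ) : toReal m ∈ σ := by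
  obtain ⟨-, e, -, h⟩ := mem_wnPiece_iff.1 hm
  exact toReal_mem_cone_of_nsmul (one_le_charPow (k := k) p e) (relint_subset _ h)

/-- A face of the cone of `S` containing a multiple of an element of a piece contains the
corresponding face. -/
lemma le_of_mem_wnPiece {p : ℕ} {σ F : PointedCone ℝ (ℝ ⊗[ℤ] M)}
    (hσ : σ.IsFaceOf (cone S)) (hF : F.IsFaceOf (cone S)) {m : M} (hm : m ∈ wnPiece p S σ)
    (hmF : toReal m ∈ F) : σ ≤ F := by
  obtain ⟨-, e, -, h⟩ := mem_wnPiece_iff.1 hm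
  refine hF.le_of_mem_relint hσ.le h ?_
  rw [toReal_nsmul]
  exact F.smul_mem (Nat.cast_nonneg _) hmF

theorem pairwiseDisjoint_wnPiece (k : Type u) [Field k] (p : ℕ) [CharP k p] (S : AddSubmonoid M) :
    Set.PairwiseDisjoint {σ : PointedCone ℝ (ℝ ⊗[ℤ] M) | σ.IsFaceOf (cone S)} (wnPiece p S) := by
  intro σ hσ τ hτ hne
  refine Set.disjoint_left.2 fun m hmσ hmτ => hne (le_antisymm ?_ ?_)
  · exact le_of_mem_wnPiece hσ hτ hmσ (toReal_mem_of_mem_wnPiece (k := k) hmτ)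
  · exact le_of_mem_wnPiece hτ hσ hmτ (toReal_mem_of_mem_wnPiece (k := k) hmσ)

lemma wn_subset_saturation {p : ℕ} : wn p S ⊆ saturation S := by
  intro m hm
  obtain ⟨σ, -, h⟩ := mem_wn_iff.1 hm
  exact (mem_wnPiece_iff.1 h).1

/-- If `σ` is the face belonging to `m`, then every element of `S ∩ σ` divides a multiple of
`m` in `S`. -/
lemma exists_nsmul_eq_nsmul_add [Module.Free ℤ M] (hS : S.FG) {p : ℕ}
    {σ : PointedCone ℝ (ℝ ⊗[ℤ] M)} (hσ : σ.IsFaceOf (cone S)) {m b : M}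
    (hm : m ∈ wnPiece p S σ) (hb : b ∈ part S σ) :
    ∃ (N K : ℕ) (c : M), 1 ≤ K ∧ c ∈ S ∧ N • m = K • b + c := by
  obtain ⟨-, e, -, h⟩ := mem_wnPiece_iff.1 hm
  obtain ⟨ε, hε, hmε⟩ := exists_sub_smul_mem_of_mem_relint h hb.2
  obtain ⟨N, hN⟩ := exists_nat_ge ε⁻¹
  -- The element is `N • (p ^ e • m - ε • b) + (N * ε - 1) • b`.
  have h1 : toReal (N • charPow p e • m - b) ∈ cone S := by
    have hNε : 0 ≤ N * ε - 1 := by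
      have := mul_le_mul_of_nonneg_right hN hε.le
      rw [inv_mul_cancel₀ hε.ne'] at this
      linarith
    have := (cone S).add_mem ((cone S).smul_mem (Nat.cast_nonneg N) (hσ.le hmε))
      ((cone S).smul_mem hNε (toReal_mem_cone hb.1))
    rw [map_sub, toReal_nsmul N]
    convert this using 1
    module
  obtain ⟨K, hK, hc⟩ := (toReal_mem_cone_iff hS).1 h1
  refine ⟨K * N * charPow p e, K, _, hK, hc, ?_⟩
  rw [smul_sub, mul_smul, mul_smul]
  abel

variable [Module.Finite ℤ M]

lemma subset_wn {p : ℕ} {m : M} (hm : m ∈ S) : m ∈ wn p S := by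
  have hmC := toReal_mem_cone hm
  refine mem_wn_iff.2 ⟨_, minFace_isFaceOf _ (toReal m), mem_wnPiece_iff.2
    ⟨⟨1, le_rfl, by simpa⟩, 0, ?_⟩⟩
  rw [charPow_zero, one_smul]
  have := self_mem_relint_minFace hmC
  exact ⟨mem_partGroup_of_mem hm (relint_subset _ this), this⟩

/-- If `m` lies in the saturation of `S` and a `p`-power multiple of `m` lies in the group of the
smallest face containing `m`, then `m` lies in `wn p S`. -/
lemma mem_wn_of_minFace {k : Type u} [Field k] {p : ℕ} [CharP k p] {m : M} (hm : m ∈ saturation S)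
    {e : ℕ} (h : charPow p e • m ∈ partGroup S (minFace (cone S) (toReal m))) : m ∈ wn p S := by
  have hmC := toReal_mem_cone_of_mem_saturation hm
  have hF := minFace_isFaceOf (cone S) (toReal m)
  have hmF := self_mem_relint_minFace hmC
  have hc : (0 : ℝ) < charPow p e := by exact_mod_cast one_le_charPow (k := k) p e
  refine mem_wn_iff.2 ⟨_, hF, mem_wnPiece_iff.2 ⟨hm, e, h, ?_⟩⟩
  rw [toReal_nsmul]
  simpa using smul_add_mem_relint hc hmF (Submodule.zero_mem _)

/-- The semigroup `wn p S`. -/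
def wnSubmonoid (k : Type u) [Field k] (p : ℕ) [CharP k p] (S : AddSubmonoid M) :
    AddSubmonoid M where
  carrier := wn p S
  zero_mem' := subset_wn S.zero_mem
  add_mem' := by
    intro a b ha hb
    obtain ⟨σ, hσ, haσ⟩ := mem_wn_iff.1 ha
    obtain ⟨τ, hτ, hbτ⟩ := mem_wn_iff.1 hb
    have has := toReal_mem_cone_of_mem_saturation (wn_subset_saturation ha)
    have hbs := toReal_mem_cone_of_mem_saturation (wn_subset_saturation hb)
    have hab : a + b ∈ saturation S := (saturationSubmonoid S).add_mem (wn_subset_saturation ha)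
      (wn_subset_saturation hb)
    have hF := minFace_isFaceOf (cone S) (toReal (a + b))
    have hxF := relint_subset _ (self_mem_relint_minFace (toReal_mem_cone_of_mem_saturation hab))
    rw [map_add] at hxF
    have hσF := le_of_mem_wnPiece hσ hF haσ (by
      rw [map_add]; exact (map_add toReal a b ▸ hF).mem_of_add_mem_left has hbs hxF)
    have hτF := le_of_mem_wnPiece hτ hF hbτ (by
      rw [map_add]; exact (map_add toReal a b ▸ hF).mem_of_add_mem_right has hbs hxF)
    obtain ⟨-, e, he, -⟩ := mem_wnPiece_iff.1 haσ
    obtain ⟨-, f, hf, -⟩ := mem_wnPiece_iff.1 hbτ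
    refine mem_wn_of_minFace (k := k) hab (e := e + f) ?_
    rw [smul_add]
    refine add_mem (partGroup_mono hσF ?_) (partGroup_mono hτF ?_)
    · rw [add_comm, charPow_add, mul_smul]
      exact nsmul_mem he _
    · rw [charPow_add, mul_smul]
      exact nsmul_mem hf _

end Pieces

/-! ### Finiteness of the saturation over `S` -/

section Remainders

variable {M : Type v} [AddCommGroup M] [Module.Free ℤ M] [Module.Finite ℤ M]

/-- The saturation of a finitely generated semigroup `S` is a finite union of translates of `S`. -/
theorem exists_finite_saturation_subset_add {S : AddSubmonoid M} (hS : S.FG) :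
    ∃ B : Set M, B.Finite ∧ B ⊆ saturation S ∧ saturation S ⊆ S + B := by
  obtain ⟨A, rfl⟩ := hS
  set S := AddSubmonoid.closure (A : Set M)
  have hA {a : M} (ha : a ∈ A) : a ∈ S := AddSubmonoid.subset_closure ha
  -- These are lattice points that are combinations of the generators with rational coefficients in
  -- `[0, 1)`; they are bounded, hence finite in number.
  let B : Set M := {b | ∃ (n : ℕ) (c : M → ℕ), 1 ≤ n ∧ (∀ a, c a < n) ∧ n • b = ∑ a ∈ A, c a • a}
  have hsum (c : M → ℕ) : ∑ a ∈ A, c a • a ∈ S := sum_mem fun a ha => nsmul_mem (hA ha) _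
  refine ⟨B, ?_, ?_, ?_⟩
  · let b := Module.Free.chooseBasis ℤ M
    have hinj : Function.Injective b.equivFun := b.equivFun.injective
    refine Set.Finite.of_finite_image (f := b.equivFun) ?_ hinj.injOn
    refine (Set.finite_Icc (fun i => -∑ a ∈ A, |b.equivFun a i|)
      (fun i => ∑ a ∈ A, |b.equivFun a i|)).subset ?_
    rintro _ ⟨x, ⟨n, c, hn, hc, hx⟩, rfl⟩
    have key (i) : |b.equivFun x i| ≤ ∑ a ∈ A, |b.equivFun a i| := by
      have h1 : (n : ℤ) * b.equivFun x i = ∑ a ∈ A, (c a : ℤ) * b.equivFun a i := by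
        have := congrArg (fun y => b.equivFun y i) hx
        simpa [-Module.Basis.equivFun_apply] using this
      have hn' : (0 : ℤ) < n := by exact_mod_cast hn
      refine le_of_mul_le_mul_left ?_ hn'
      calc (n : ℤ) * |b.equivFun x i| = |(n : ℤ) * b.equivFun x i| := by
            rw [abs_mul, abs_of_pos hn']
        _ ≤ ∑ a ∈ A, |(c a : ℤ) * b.equivFun a i| := by
            rw [h1]; exact Finset.abs_sum_le_sum_abs _ _
        _ ≤ ∑ a ∈ A, (n : ℤ) * |b.equivFun a i| := by
            refine Finset.sum_le_sum fun a _ => ?_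
            rw [abs_mul]
            refine mul_le_mul_of_nonneg_right ?_ (abs_nonneg _)
            rw [Nat.abs_cast]
            exact_mod_cast (hc a).le
        _ = _ := by rw [Finset.mul_sum]
    exact ⟨fun i => (abs_le.1 (key i)).1, fun i => (abs_le.1 (key i)).2⟩
  · rintro x ⟨n, c, hn, -, hx⟩
    exact ⟨n, hn, hx ▸ hsum c⟩
  · rintro x ⟨n, hn, hx⟩
    obtain ⟨c, hc⟩ : ∃ c : M → ℕ, n • x = ∑ a ∈ A, c a • a := by
      obtain ⟨f, -, hf⟩ := AddSubmonoid.mem_closure_finset.1 hx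
      exact ⟨f, hf.symm⟩
    -- Divide each coefficient by `n`: the quotients give an element of `S`, the remainders an
    -- element of `B`.
    refine ⟨∑ a ∈ A, (c a / n) • a, hsum _, x - ∑ a ∈ A, (c a / n) • a,
      ⟨n, fun a => c a % n, hn, fun a => Nat.mod_lt _ hn, ?_⟩, by simp⟩
    rw [smul_sub, hc, Finset.smul_sum, ← Finset.sum_sub_distrib]
    refine Finset.sum_congr rfl fun a _ => ?_
    rw [sub_eq_iff_eq_add, ← mul_smul, ← add_smul, Nat.mod_add_div]

end Remainders
end WeakNormalization

namespace WeakNormalization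

/-! ### Lifting homomorphisms and integral closedness in localizations -/

section General

/-- A ring homomorphism lifts along an injective ring homomorphism whose range contains its
range. -/
lemma exists_ringHom_comp_eq {A B C : Type*} [CommRing A] [CommRing B] [CommRing C] (j : A →+* B)
    (hj : Function.Injective j) (g : C →+* B) (h : ∀ c, ∃ a, j a = g c) :
    ∃ g' : C →+* A, j.comp g' = g := by
  let e : A ≃+* j.range := RingEquiv.ofBijective j.rangeRestrict
    ⟨fun a b hab => hj (congrArg Subtype.val hab), j.rangeRestrict_surjective⟩
  refine ⟨e.symm.toRingHom.comp (g.codRestrict j.range h), ?_⟩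
  ext c
  have : e (e.symm ⟨g c, h c⟩) = ⟨g c, h c⟩ := e.apply_symm_apply _
  exact congrArg Subtype.val this

/-- An integrally closed domain is integrally closed in its localizations. -/
lemma exists_algebraMap_eq_of_isIntegral_of_isLocalization {A B : Type*} [CommRing A] [IsDomain A]
    [IsIntegrallyClosed A] [CommRing B] [Algebra A B] (P : Submonoid A) (hP : P ≤ nonZeroDivisors A)
    [IsLocalization P B] {x : B} (hx : IsIntegral A x) : ∃ y, algebraMap A B y = x := by
  have hu (y : P) : IsUnit (algebraMap A (FractionRing A) y) :=
    IsLocalization.map_units (FractionRing A) (⟨y, hP y.2⟩ : nonZeroDivisors A)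
  let l : B →+* FractionRing A := IsLocalization.lift (M := P) hu
  have hl (a : A) : l (algebraMap A B a) = algebraMap A (FractionRing A) a :=
    IsLocalization.lift_eq hu a
  have hinj : Function.Injective l := by
    refine (IsLocalization.lift_injective_iff _).2 fun a b => ?_
    rw [(IsLocalization.injective B hP).eq_iff, (IsFractionRing.injective A (FractionRing A)).eq_iff]
  let l' : B →ₐ[A] FractionRing A := { l with commutes' := hl }
  obtain ⟨y, hy⟩ := IsIntegrallyClosed.isIntegral_iff.1 (hx.map l')
  exact ⟨y, hinj ((hl y).trans hy)⟩

end General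

/-! ### Characters separating points from subgroups -/

section Characters

variable {k : Type u} [Field k] [IsAlgClosed k] {M : Type v} [AddCommGroup M]

/-- The group of units of an algebraically closed field is divisible, hence injective. -/
lemma exists_addMonoidHom_units_extension {A B : Type*} [AddCommGroup A] [AddCommGroup B]
    (f : A →+ B) (hf : Function.Injective f) (g : A →+ Additive kˣ) :
    ∃ h : B →+ Additive kˣ, h.comp f = g := by
  have hd : ∀ {n : ℕ}, n ≠ 0 → Function.Surjective (fun a : Additive kˣ => n • a) := by
    intro n hn a
    obtain ⟨z, hz⟩ := IsAlgClosed.exists_pow_nat_eq (a.toMul : k) (Nat.pos_of_ne_zero hn)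
    have hz0 : z ≠ 0 := by
      rintro rfl
      rw [zero_pow hn] at hz
      exact a.toMul.ne_zero hz.symm
    refine ⟨Additive.ofMul (Units.mk0 z hz0), ?_⟩
    apply Additive.toMul.injective
    ext
    simpa using hz
  let : DivisibleBy (Additive kˣ) ℕ := divisibleByOfSMulRightSurj _ _ hd
  let : DivisibleBy (Additive kˣ) ℤ := AddGroup.divisibleByIntOfDivisibleByNat _
  exact (Module.Baer.of_divisible _).extension_property_addMonoidHom f hf g

/-- Over an algebraically closed field of characteristic `p`, characters separate a torsion element
of order not a power of `p` from zero. -/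
theorem exists_character_ne_one {p : ℕ} [CharP k p] (G : AddSubgroup M) {m : M} {N : ℕ}
    (hN : 1 ≤ N) (hm : N • m ∈ G) (h : ∀ e, charPow p e • m ∉ G) :
    ∃ χ : Multiplicative M →* kˣ, (∀ g ∈ G, χ (.ofAdd g) = 1) ∧ χ (.ofAdd m) ≠ 1 := by
  let x : M ⧸ G := QuotientAddGroup.mk m
  have hx (n : ℕ) : n • x = 0 ↔ n • m ∈ G := by
    rw [← QuotientAddGroup.eq_zero_iff]; rfl
  set n := addOrderOf x with hn
  have hn0 : 0 < n :=
    addOrderOf_pos_iff.2 (isOfFinAddOrder_iff_nsmul_eq_zero.2 ⟨N, hN, (hx N).2 hm⟩)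
  -- Take for `d` the prime-to-`p` part of the order. It is not `1` because the order is not a power
  -- of `p`, and `k` contains a primitive `d`-th root of unity, to which `x` will be sent.
  obtain ⟨d, hdn, hd1, hdk⟩ : ∃ d, d ∣ n ∧ d ≠ 1 ∧ (d : k) ≠ 0 := by
    by_cases hp : p = 0
    · subst hp
      refine ⟨n, dvd_rfl, fun h1 => h 0 ?_, fun h0 => hn0.ne' ?_⟩
      · rw [charPow_zero, ← hx, one_smul]
        exact AddMonoid.addOrderOf_eq_one_iff.1 h1
      · exact Nat.eq_zero_of_zero_dvd ((CharP.cast_eq_zero_iff k 0 n).1 h0)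
    · have hp1 : p ≠ 1 := CharP.char_ne_one k p
      obtain ⟨a, d, hd, had⟩ := Nat.exists_eq_pow_mul_and_not_dvd hn0.ne' p hp1
      refine ⟨d, ⟨p ^ a, by rw [had, mul_comm]⟩, ?_, fun h0 => hd ((CharP.cast_eq_zero_iff k p d).1 h0)⟩
      rintro rfl
      refine h a ((hx _).1 ?_)
      rw [charPow, if_neg hp, ← mul_one (p ^ a), ← had, hn]
      exact addOrderOf_nsmul_eq_zero x
  have : NeZero (d : k) := ⟨hdk⟩
  obtain ⟨ζ, hζ⟩ := HasEnoughRootsOfUnity.exists_primitiveRoot k d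
  have hd0 : d ≠ 0 := by rintro rfl; simp at hdk
  let w : Additive kˣ := Additive.ofMul (hζ.isUnit hd0).unit
  have hw : n • w = 0 := by
    apply Additive.toMul.injective
    ext
    simpa [w] using (hζ.pow_eq_one_iff_dvd n).2 hdn
  have hw0 : w ≠ 0 := by
    intro h0
    have : ζ = 1 := by simpa [w] using congrArg (fun z : Additive kˣ => (z.toMul : k)) h0
    exact hζ.ne_one (by omega) this
  have hnx : zmultiplesHom (M ⧸ G) x n = 0 := by
    simp [hn, addOrderOf_nsmul_eq_zero]
  have hnw : zmultiplesHom (Additive kˣ) w n = 0 := by simpa using hw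
  let f : ZMod n →+ M ⧸ G := ZMod.lift n ⟨zmultiplesHom _ x, hnx⟩
  have hf : Function.Injective f := by
    refine (ZMod.lift_injective _).2 fun i hi => ?_
    rw [ZMod.intCast_zmod_eq_zero_iff_dvd, hn]
    exact addOrderOf_dvd_iff_zsmul_eq_zero.2 (by simpa using hi)
  obtain ⟨g, hg⟩ := exists_addMonoidHom_units_extension f hf
    (ZMod.lift n ⟨zmultiplesHom (Additive kˣ) w, hnw⟩)
  have hgx : g x = w := by
    have h1 := DFunLike.congr_fun hg ((1 : ℤ) : ZMod n)
    have h2 : f ((1 : ℤ) : ZMod n) = x := (ZMod.lift_coe _ _ _).trans (one_zsmul x)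
    rw [AddMonoidHom.comp_apply, h2] at h1
    exact h1.trans ((ZMod.lift_coe _ _ _).trans (one_zsmul w))
  refine ⟨AddMonoidHom.toMultiplicativeLeft (g.comp (QuotientAddGroup.mk' G)), fun y hy => ?_, ?_⟩
  · have : QuotientAddGroup.mk' G y = 0 := (QuotientAddGroup.eq_zero_iff y).2 hy
    change (g (QuotientAddGroup.mk' G y)).toMul = 1
    rw [this, map_zero]
    rfl
  · change (g x).toMul ≠ 1
    rw [hgx]
    exact hw0

end Characters

/-! ### Semigroup algebras inside the Laurent polynomial ring -/

section SemigroupAlgebras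

open AddMonoidAlgebra

variable (k : Type u) [Field k] {M : Type v} [AddCommGroup M]

/-- The inclusion `k[S] → k[T]` induced by an inclusion of semigroups. -/
noncomputable abbrev incl {S T : AddSubmonoid M} (h : S ≤ T) :
    AddMonoidAlgebra k S →+* AddMonoidAlgebra k T :=
  (mapDomainAlgHom k k (AddSubmonoid.inclusion h)).toRingHom

/-- The inclusion `k[S] → k[M]` of the semigroup algebra in the group algebra. -/
noncomputable abbrev emb (S : AddSubmonoid M) : AddMonoidAlgebra k S →+* AddMonoidAlgebra k M :=
  (mapDomainAlgHom k k S.subtype).toRingHom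

lemma incl_single {S T : AddSubmonoid M} (h : S ≤ T) (s : S) (a : k) :
    incl k h (single s a) = single ⟨s, h s.2⟩ a := mapDomain_single

lemma emb_single {S : AddSubmonoid M} (s : S) (a : k) :
    emb k S (single s a) = single (s : M) a := mapDomain_single

lemma emb_injective (S : AddSubmonoid M) : Function.Injective (emb k S) :=
  mapDomain_injective Subtype.val_injective

lemma emb_comp_incl {S T : AddSubmonoid M} (h : S ≤ T) :
    (emb k T).comp (incl k h) = emb k S := by
  ext x
  · simp
  · simp

lemma exists_emb_eq {S : AddSubmonoid M} (f : AddMonoidAlgebra k M)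
    (hf : ∀ m, f.coeff m ≠ 0 → m ∈ S) : ∃ g, emb k S g = f := by
  refine ⟨comapDomain S.subtype Subtype.val_injective f, mapDomain_comapDomain ?_ _⟩
  intro m hm
  exact ⟨⟨m, hf m (by simpa using hm)⟩, rfl⟩

lemma coeff_emb {S : AddSubmonoid M} (f : AddMonoidAlgebra k S) (s : S) :
    (emb k S f).coeff s = f.coeff s :=
  Finsupp.mapDomain_apply Subtype.val_injective _ _

/-- If every element of a group becomes an element of `Q` after adding a multiple of `s ∈ Q`, then
the group algebra is the localization of the semigroup algebra of `Q` at the monomial of `s`. -/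
lemma isLocalization_away_single {Q : Type*} [AddCommMonoid Q] (i : Q →+ M)
    (hi : Function.Injective i) (s : Q) (hs : ∀ m : M, ∃ (n : ℕ) (q : Q), m + n • i s = i q) :
    letI := (mapDomainAlgHom k k i).toRingHom.toAlgebra
    IsLocalization.Away (single s (1 : k)) (AddMonoidAlgebra k M) := by
  let := (mapDomainAlgHom k k i).toRingHom.toAlgebra
  have hmap (x : AddMonoidAlgebra k Q) :
      algebraMap (AddMonoidAlgebra k Q) (AddMonoidAlgebra k M) x = mapDomain i x := rfl
  have hpow (n : ℕ) : (single s (1 : k)) ^ n = single (n • s) 1 := by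
    rw [single_pow, one_pow]
  refine ⟨?_, ?_, ?_⟩
  · rintro ⟨_, n, rfl⟩
    rw [hmap]
    simp only [hpow, mapDomain_single]
    refine IsUnit.of_mul_eq_one (single (-(i (n • s))) 1) ?_
    rw [single_mul_single, add_neg_cancel, one_mul]
    rfl
  · intro z
    suffices ∃ (n : ℕ) (x : AddMonoidAlgebra k Q), z * mapDomain i (single (n • s) 1) =
        mapDomain i x by
      obtain ⟨n, x, h⟩ := this
      refine ⟨⟨x, ⟨_, n, rfl⟩⟩, ?_⟩
      simp only [hmap, hpow]
      exact h
    induction z using AddMonoidAlgebra.induction_linear with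
    | zero => exact ⟨0, 0, by simp⟩
    | add f g hf hg =>
      obtain ⟨a, x, hx⟩ := hf
      obtain ⟨b, y, hy⟩ := hg
      refine ⟨a + b, x * single (b • s) 1 + y * single (a • s) 1, ?_⟩
      have : (single ((a + b) • s) (1 : k)) = single (a • s) 1 * single (b • s) 1 := by
        rw [single_mul_single, add_smul, one_mul]
      rw [this, mapDomain_add, mapDomain_mul, mapDomain_mul, mapDomain_mul, ← hx, ← hy]
      ring
    | single m a =>
      obtain ⟨n, q, hq⟩ := hs m
      refine ⟨n, single q a, ?_⟩
      rw [mapDomain_single, mapDomain_single, single_mul_single, mul_one, map_nsmul, hq]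
  · intro x y hxy
    rw [hmap, hmap] at hxy
    exact ⟨1, by rw [mapDomain_injective hi hxy]⟩

instance isDomain_addMonoidAlgebra [Module.Free ℤ M] : IsDomain (AddMonoidAlgebra k M) :=
  let b := Module.Free.chooseBasis ℤ M
  have : TwoUniqueSums M := .of_injective_addHom
    b.repr.toAddEquiv.toAddHom b.repr.injective inferInstance
  inferInstance

instance isDomain_addMonoidAlgebra_submonoid [Module.Free ℤ M] (S : AddSubmonoid M) :
    IsDomain (AddMonoidAlgebra k S) :=
  (emb_injective k S).isDomain _

/-- The ring of Laurent polynomials in finitely many variables is integrally closed. -/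
theorem isIntegrallyClosed_addMonoidAlgebra [Module.Free ℤ M] [Module.Finite ℤ M] :
    IsIntegrallyClosed (AddMonoidAlgebra k M) := by
  let b := Module.Free.chooseBasis ℤ M
  set ι := Module.Free.ChooseBasisIndex ℤ M
  let i : (ι →₀ ℕ) →+ M :=
    b.repr.symm.toAddEquiv.toAddMonoidHom.comp (Finsupp.mapRange.addMonoidHom (Nat.castAddMonoidHom ℤ))
  have hib (f : ι →₀ ℕ) (j : ι) : b.repr (i f) j = f j := by simp [i]
  have hi : Function.Injective i := fun f g hfg => by
    ext j
    have := congrArg (fun x => b.repr x j) hfg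
    simpa [hib] using this
  -- The exponent of the product of all variables; inverting that monomial turns the polynomial ring
  -- into `k[M]`.
  let s : ι →₀ ℕ := Finsupp.equivFunOnFinite.symm fun _ => 1
  have hs (m : M) : ∃ (n : ℕ) (q : ι →₀ ℕ), m + n • i s = i q := by
    refine ⟨∑ j, (b.repr m j).natAbs, Finsupp.equivFunOnFinite.symm
      fun j => (b.repr m j + ∑ j, (b.repr m j).natAbs).toNat, ?_⟩
    apply b.repr.injective
    ext j
    rw [hib]
    have h1 : ((b.repr m j).natAbs : ℤ) ≤ ∑ j, ((b.repr m j).natAbs : ℤ) :=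
      Finset.single_le_sum (f := fun j => ((b.repr m j).natAbs : ℤ)) (fun _ _ => by positivity)
        (Finset.mem_univ j)
    rw [map_add, map_nsmul, Finsupp.add_apply, Finsupp.smul_apply, hib]
    simp only [s, Finsupp.equivFunOnFinite_symm_apply_apply]
    rw [Int.toNat_of_nonneg (by push_cast [-Int.natCast_natAbs]; omega)]
    simp
  have : IsIntegrallyClosed (MvPolynomial ι k) := inferInstance
  have : IsIntegrallyClosed (AddMonoidAlgebra k (ι →₀ ℕ)) := this
  have : IsDomain (MvPolynomial ι k) := inferInstance
  have : IsDomain (AddMonoidAlgebra k (ι →₀ ℕ)) := this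
  let := (mapDomainAlgHom k k i).toRingHom.toAlgebra
  have := isLocalization_away_single k i hi s hs
  refine isIntegrallyClosed_of_isLocalization _ (Submonoid.powers (single s (1 : k))) ?_
  refine powers_le_nonZeroDivisors_of_noZeroDivisors ?_
  simp [← coeff_inj]

end SemigroupAlgebras

end WeakNormalization

namespace WeakNormalization

open AddMonoidAlgebra

/-! ### Elements integral over `k[S]` are supported on the saturation -/

section Integrality

variable (k : Type u) [Field k] {M : Type v} [AddCommGroup M] {S : AddSubmonoid M}

/-- The homomorphism `k[M] → k[M][T;T⁻¹]` sending the monomial of `m` to its product with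
`T ^ l m`. -/
noncomputable def twist (l : M →+ ℤ) :
    AddMonoidAlgebra k M →ₐ[k] LaurentPolynomial (AddMonoidAlgebra k M) :=
  AddMonoidAlgebra.lift k _ M
    { toFun := fun m => LaurentPolynomial.C (single m.toAdd 1) * LaurentPolynomial.T (l m.toAdd)
      map_one' := by
        rw [toAdd_one, map_zero, LaurentPolynomial.T_zero, mul_one]
        exact map_one _
      map_mul' := fun a b => by
        rw [toAdd_mul, map_add, LaurentPolynomial.T_add, ← one_mul (1 : k), ← single_mul_single,
          one_mul, map_mul]
        ring }

lemma twist_single (l : M →+ ℤ) (m : M) (a : k) :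
    twist k l (single m a) = LaurentPolynomial.C (single m a) * LaurentPolynomial.T (l m) := by
  rw [twist, AddMonoidAlgebra.lift_single]
  simp only [MonoidHom.coe_mk, OneHom.coe_mk, toAdd_ofAdd]
  rw [Algebra.smul_def, ← mul_assoc]
  congr 1
  rw [IsScalarTower.algebraMap_apply k (AddMonoidAlgebra k M), ← LaurentPolynomial.C_eq_algebraMap,
    ← map_mul, ← Algebra.smul_def, smul_single, smul_eq_mul, mul_one]

/-- A monomial of `f` on which `l` is negative thus forces a negative power of `T` in the twist. -/
lemma coeff_twist (l : M →+ ℤ) (f : AddMonoidAlgebra k M) (m : M) :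
    ((twist k l f).coeff (l m)).coeff m = f.coeff m := by
  induction f using AddMonoidAlgebra.induction_linear with
  | zero => simp
  | add f g hf hg => simp [hf, hg]
  | single x a =>
    have hC (b : AddMonoidAlgebra k M) (i j : ℤ) :
        (LaurentPolynomial.C b * LaurentPolynomial.T i).coeff j = if i = j then b else 0 := by
      rw [← LaurentPolynomial.single_eq_C_mul_T, coeff_single, Finsupp.single_apply]
    rw [twist_single, hC]
    by_cases hx : x = m
    · subst hx; simp
    · by_cases hl : l x = l m
      · simp [hl, Finsupp.single_eq_of_ne (Ne.symm hx)]
      · simp [hl, Finsupp.single_eq_of_ne (Ne.symm hx)]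

variable [Module.Free ℤ M] [Module.Finite ℤ M]

/-- A linear form that is nonnegative on `S` is nonnegative on the support of elements of `k[M]`
that are integral over `k[S]`. -/
lemma nonneg_of_isIntegralElem {f : AddMonoidAlgebra k M} (hf : (emb k S).IsIntegralElem f)
    (l : M →+ ℤ) (hl : ∀ s ∈ S, 0 ≤ l s) {m : M} (hm : f.coeff m ≠ 0) : 0 ≤ l m := by
  have := isIntegrallyClosed_addMonoidAlgebra k (M := M)
  let L := AddMonoidAlgebra k M
  -- As `l` is nonnegative on `S`, the twist maps `k[S]` to `L[T]`. So the twist of `f` is integral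
  -- over the integrally closed ring `L[T]`, hence lies in it.
  let ψ : AddMonoidAlgebra k S →ₐ[k] Polynomial L := AddMonoidAlgebra.lift k _ S
    { toFun := fun s => Polynomial.C (single (s.toAdd : M) 1) * Polynomial.X ^ (l s.toAdd).toNat
      map_one' := by
        simp only [toAdd_one, ZeroMemClass.coe_zero, map_zero, Int.toNat_zero, pow_zero, mul_one]
        exact map_one _
      map_mul' := fun a b => by
        rw [toAdd_mul, AddSubmonoid.coe_add, map_add,
          Int.toNat_add (hl _ a.toAdd.2) (hl _ b.toAdd.2), pow_add, ← one_mul (1 : k),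
          ← single_mul_single, one_mul, map_mul]
        ring }
  have hψs (s : S) (a : k) : ψ (single s a) =
      Polynomial.C (single (s : M) a) * Polynomial.X ^ (l s).toNat := by
    rw [AddMonoidAlgebra.lift_single]
    simp only [MonoidHom.coe_mk, OneHom.coe_mk, toAdd_ofAdd]
    rw [Algebra.smul_def, ← mul_assoc]
    congr 1
    rw [IsScalarTower.algebraMap_apply k L, ← Polynomial.C_eq_algebraMap, ← map_mul,
      ← Algebra.smul_def, smul_single, smul_eq_mul, mul_one]
  have hψ' (s : S) (a : k) : (algebraMap (Polynomial L) (LaurentPolynomial L)) (ψ (single s a)) =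
      twist k l (emb k S (single s a)) := by
    rw [hψs, emb_single, twist_single, LaurentPolynomial.algebraMap_eq_toLaurent,
      Polynomial.toLaurent_C_mul_X_pow, Int.toNat_of_nonneg (hl s s.2)]
  have hψ : (algebraMap (Polynomial L) (LaurentPolynomial L)).comp ψ.toRingHom =
      (twist k l).toRingHom.comp (emb k S) :=
    AddMonoidAlgebra.ringHom_ext (fun a => hψ' 0 a) fun s => hψ' s 1
  have h1 : IsIntegral (Polynomial L) (twist k l f) := by
    obtain ⟨q, hq, hqf⟩ := hf
    refine ⟨q.map ψ.toRingHom, hq.map _, ?_⟩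
    rw [Polynomial.eval₂_map, hψ]
    exact (Polynomial.hom_eval₂ q (emb k S) (twist k l).toRingHom f).symm.trans
      (by rw [hqf, map_zero])
  obtain ⟨g, hg⟩ := exists_algebraMap_eq_of_isIntegral_of_isLocalization
    (Submonoid.powers (Polynomial.X : Polynomial L))
    (powers_le_nonZeroDivisors_of_noZeroDivisors Polynomial.X_ne_zero) h1
  by_contra hneg
  apply hm
  rw [← coeff_twist k l, ← hg, LaurentPolynomial.algebraMap_eq_toLaurent,
    LaurentPolynomial.coeff_toLaurent]
  have : g.toFinsupp.coeff.mapDomain Nat.castEmbedding (l m) = 0 := by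
    refine Finsupp.mapDomain_of_notMem_range _ _ ?_
    rintro ⟨n, hn⟩
    have : (n : ℤ) = l m := hn
    omega
  rw [this]
  simp

theorem mem_saturation_of_isIntegralElem (hS : S.FG) {f : AddMonoidAlgebra k M}
    (hf : (emb k S).IsIntegralElem f) {m : M} (hm : f.coeff m ≠ 0) : m ∈ saturation S := by
  refine (mem_saturation_or_exists_neg hS m).resolve_right ?_
  rintro ⟨l, hl, hlm⟩
  exact absurd (nonneg_of_isIntegralElem k hf l hl hm) (not_le.2 hlm)

/-- An element of the fraction field of `k[M]` that is integral over `k[S]` comes from the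
semigroup algebra of the saturation of `S`. -/
theorem exists_algebraMap_emb_eq_of_isIntegralElem (hS : S.FG)
    {x : FractionRing (AddMonoidAlgebra k M)}
    (hx : ((algebraMap (AddMonoidAlgebra k M) (FractionRing (AddMonoidAlgebra k M))).comp
      (emb k S)).IsIntegralElem x) :
    ∃ f, algebraMap _ _ (emb k (saturationSubmonoid S) f) = x := by
  have := isIntegrallyClosed_addMonoidAlgebra k (M := M)
  obtain ⟨q, hq, hqx⟩ := hx
  rw [← Polynomial.eval₂_map] at hqx
  obtain ⟨y, rfl⟩ := IsIntegrallyClosed.isIntegral_iff.1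
    (⟨q.map (emb k S), hq.map _, hqx⟩ : IsIntegral (AddMonoidAlgebra k M) x)
  rw [Polynomial.eval₂_map, ← Polynomial.hom_eval₂,
    map_eq_zero_iff _ (IsFractionRing.injective _ _)] at hqx
  obtain ⟨f, hf⟩ := exists_emb_eq (S := saturationSubmonoid S) k y
    fun m hm => mem_saturation_of_isIntegralElem k hS ⟨q, hq, hqx⟩ hm
  exact ⟨f, by rw [hf]⟩

end Integrality

/-! ### Face homomorphisms twisted by characters -/

section Faces

variable {k : Type u} [Field k] {M : Type v} [AddCommGroup M] {S : AddSubmonoid M}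

open Classical in
/-- The homomorphism from the semigroup algebra of the saturation of `S` to `k[M]` which multiplies
the monomials in a face by the values of a character, and sends the other monomials to zero. -/
noncomputable def faceHom {F : PointedCone ℝ (ℝ ⊗[ℤ] M)} (hF : F.IsFaceOf (cone S))
    (χ : Multiplicative M →* kˣ) :
    AddMonoidAlgebra k (saturationSubmonoid S) →ₐ[k] AddMonoidAlgebra k M :=
  AddMonoidAlgebra.lift k _ _
    { toFun := fun m => if toReal (m.toAdd : M) ∈ F then
        single (m.toAdd : M) (χ (.ofAdd (m.toAdd : M)) : k) else 0
      map_one' := by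
        simp only [toAdd_one, ZeroMemClass.coe_zero, map_zero, Submodule.zero_mem, if_true,
          ofAdd_zero, map_one, Units.val_one]
        rfl
      map_mul' := fun a b => by
        have := hF.add_mem_iff_mem (toReal_mem_cone_of_mem_saturation a.toAdd.2)
          (toReal_mem_cone_of_mem_saturation b.toAdd.2)
        rw [toAdd_mul, AddSubmonoid.coe_add, map_add, ofAdd_add, map_mul, Units.val_mul, this]
        by_cases ha : toReal (a.toAdd : M) ∈ F <;> by_cases hb : toReal (b.toAdd : M) ∈ F <;>
          simp [ha, hb, single_mul_single] }

open Classical in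
lemma faceHom_single {F : PointedCone ℝ (ℝ ⊗[ℤ] M)} (hF : F.IsFaceOf (cone S))
    (χ : Multiplicative M →* kˣ) (m : saturationSubmonoid S) (a : k) :
    faceHom hF χ (single m a) =
      if toReal (m : M) ∈ F then single (m : M) (a * χ (.ofAdd (m : M))) else 0 := by
  rw [faceHom, AddMonoidAlgebra.lift_single]
  simp only [MonoidHom.coe_mk, OneHom.coe_mk, toAdd_ofAdd]
  split_ifs <;> simp

/-- Since `faceHom` takes values in `k[M]` rather than `k`, distinct monomials stay apart and each
can be tested separately. -/
lemma coeff_faceHom {F : PointedCone ℝ (ℝ ⊗[ℤ] M)} (hF : F.IsFaceOf (cone S))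
    (χ : Multiplicative M →* kˣ) (f : AddMonoidAlgebra k (saturationSubmonoid S))
    (m : saturationSubmonoid S) (hm : toReal (m : M) ∈ F) :
    (faceHom hF χ f).coeff m = f.coeff m * χ (.ofAdd (m : M)) := by
  induction f using AddMonoidAlgebra.induction_linear with
  | zero => simp
  | add f g hf hg => simp [hf, hg, add_mul]
  | single x a =>
    rw [faceHom_single]
    by_cases hx : x = m
    · subst hx
      rw [if_pos hm]
      simp
    · have hx' : (m : M) ≠ x := fun h => hx (Subtype.ext h.symm)
      split_ifs <;> simp [Finsupp.single_eq_of_ne (Ne.symm hx), Finsupp.single_eq_of_ne hx']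

lemma le_saturationSubmonoid (S : AddSubmonoid M) : S ≤ saturationSubmonoid S :=
  fun s hs => ⟨1, le_rfl, by simpa⟩

/-- If any two homomorphisms on the semigroup algebra of the saturation that agree on `k[S]`
agree at `f`, then the support of `f` lies in `wn p S`. -/
theorem mem_wn_of_forall_ringHom_eq [IsAlgClosed k] {p : ℕ} [CharP k p] [Module.Finite ℤ M]
    (f : AddMonoidAlgebra k (saturationSubmonoid S))
    (hf : ∀ α β : AddMonoidAlgebra k (saturationSubmonoid S) →+* AddMonoidAlgebra k M,
      α.comp (incl k (le_saturationSubmonoid S)) = β.comp (incl k (le_saturationSubmonoid S)) →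
        α f = β f) {m : saturationSubmonoid S} (hm : f.coeff m ≠ 0) : (m : M) ∈ wn p S := by
  by_contra hwn
  have hF := minFace_isFaceOf (cone S) (toReal (m : M))
  have hmF := relint_subset _ (self_mem_relint_minFace (toReal_mem_cone_of_mem_saturation m.2))
  set F := minFace (cone S) (toReal (m : M))
  obtain ⟨N, hN, hNm⟩ := m.2
  have hNF : N • (m : M) ∈ partGroup S F := by
    refine mem_partGroup_of_mem hNm ?_
    rw [toReal_nsmul]
    exact F.smul_mem (Nat.cast_nonneg _) hmF
  obtain ⟨χ, hχ, hχm⟩ := exists_character_ne_one (k := k) (p := p) (partGroup S F) hN hNF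
    fun e he => hwn (mem_wn_of_minFace (k := k) m.2 he)
  -- A monomial of `S` is either in `F`, where `χ` is trivial on it, or killed by both
  -- homomorphisms.
  have hs (s : S) (a : k) : faceHom hF χ (incl k (le_saturationSubmonoid S) (single s a)) =
      faceHom hF 1 (incl k (le_saturationSubmonoid S) (single s a)) := by
    rw [incl_single, faceHom_single, faceHom_single]
    split_ifs with h
    · rw [hχ _ (mem_partGroup_of_mem s.2 h), MonoidHom.one_apply]
    · rfl
  have h := hf (faceHom hF χ).toRingHom (faceHom hF 1).toRingHom
    (AddMonoidAlgebra.ringHom_ext (fun a => hs 0 a) fun s => hs s 1)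
  have h2 := congrArg (fun g => g.coeff (m : M)) h
  simp only [AlgHom.toRingHom_eq_coe, RingHom.coe_coe, coeff_faceHom hF _ f m hmF] at h2
  apply hχm
  ext
  simpa [hm] using h2

end Faces

/-! ### Uniqueness of extensions of field-valued points -/

section FieldPoints

variable {k : Type u} [Field k] {M : Type v} [AddCommGroup M] [Module.Free ℤ M] {S T : AddSubmonoid M}

lemma eq_of_pow_charPow_eq {p : ℕ} [CharP k p] {L : Type*} [Field L] (i : k →+* L) {e : ℕ} {x y : L}
    (h : x ^ charPow p e = y ^ charPow p e) : x = y := by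
  unfold charPow at h
  split_ifs at h with hp
  · simpa using h
  · have : CharP L p := (i.charP_iff i.injective p).1 inferInstance
    have : Fact p.Prime := ⟨(CharP.char_is_prime_or_zero k p).resolve_right hp⟩
    have : ExpChar L p := ExpChar.prime Fact.out
    exact iterateFrobenius_inj L p e (by simpa [iterateFrobenius_def] using h)

/-- Homomorphisms from `k[T]`, `T ≤ wn p S`, to a field that agree on `k[S]` are equal. -/
theorem ringHom_eq_of_comp_incl_eq {p : ℕ} [CharP k p] (hS : S.FG) (hST : S ≤ T)
    (hT : (T : Set M) ⊆ wn p S) {L : Type*} [Field L] (α β : AddMonoidAlgebra k T →+* L)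
    (h : α.comp (incl k hST) = β.comp (incl k hST)) : α = β := by
  have hs (s : M) (hs : s ∈ S) (a : k) : α (single ⟨s, hST hs⟩ a) = β (single ⟨s, hST hs⟩ a) := by
    have := RingHom.congr_fun h (single ⟨s, hs⟩ a)
    simpa only [RingHom.comp_apply, incl_single] using this
  have hpow (γ : AddMonoidAlgebra k T →+* L) (n : ℕ) (t : T) :
      γ (single (n • t) 1) = γ (single t 1) ^ n := by
    rw [← map_pow, single_pow, one_pow]
  have hadd (γ : AddMonoidAlgebra k T →+* L) (s t : T) :
      γ (single (s + t) 1) = γ (single s 1) * γ (single t 1) := by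
    rw [← map_mul, single_mul_single, one_mul]
  have key (t : T) : α (single t 1) = β (single t 1) := by
    obtain ⟨σ, hσ, ht⟩ := mem_wn_iff.1 (hT t.2)
    obtain ⟨⟨n, hn, hnt⟩, e, ⟨a, ha, b, hb, hab⟩, -⟩ := mem_wnPiece_iff.1 ht
    have hn' : n ≠ 0 := by omega
    have hnt' : α (single t 1) ^ n = β (single t 1) ^ n := by
      rw [← hpow, ← hpow]
      exact hs _ hnt 1
    by_cases h0 : α (single t 1) = 0
    · rw [h0, zero_pow hn'] at hnt'
      rw [h0, pow_eq_zero_iff hn' |>.1 hnt'.symm]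
    · obtain ⟨N, K, c, hK, hc, hNK⟩ := exists_nsmul_eq_nsmul_add hS hσ ht hb
      -- As `b` divides a multiple of `t`, its image is nonzero and can be cancelled from the
      -- relation `p ^ e • t + b = a`.
      have hb0 : α (single ⟨b, hST hb.1⟩ 1) ≠ 0 := by
        intro hb0
        have : N • t = K • (⟨b, hST hb.1⟩ : T) + ⟨c, hST hc⟩ := Subtype.ext hNK
        have h1 := hpow α N t
        rw [this, hadd, hpow, hb0, zero_pow (by omega), zero_mul] at h1
        exact h0 (eq_zero_of_pow_eq_zero h1.symm)
      have hab' : charPow p e • t + (⟨b, hST hb.1⟩ : T) = ⟨a, hST ha.1⟩ :=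
        Subtype.ext (sub_eq_iff_eq_add.1 hab).symm
      have h1 := hadd α (charPow p e • t) ⟨b, hST hb.1⟩
      have h2 := hadd β (charPow p e • t) ⟨b, hST hb.1⟩
      rw [hab', hpow] at h1 h2
      rw [← hs b hb.1, ← hs a ha.1, h1] at h2
      exact eq_of_pow_charPow_eq (k := k) (p := p) (α.comp (algebraMap k _))
        (mul_right_cancel₀ hb0 h2)
  exact AddMonoidAlgebra.ringHom_ext (fun a => hs 0 S.zero_mem a) key

end FieldPoints

end WeakNormalization

namespace WeakNormalization

open AddMonoidAlgebra

/-! ### Injectivity and finiteness of the inclusions -/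

section Injectivity

variable (k : Type u) [Field k] {M : Type v} [AddCommGroup M] {S T : AddSubmonoid M}

lemma incl_injective (hST : S ≤ T) : Function.Injective (incl k hST) :=
  mapDomain_injective (AddSubmonoid.inclusion_injective hST)

/-- The inclusion of `k[S]` in the fraction field of `k[M]`. -/
noncomputable abbrev toFractionRing (S : AddSubmonoid M) :
    AddMonoidAlgebra k S →+* FractionRing (AddMonoidAlgebra k M) :=
  (algebraMap (AddMonoidAlgebra k M) (FractionRing (AddMonoidAlgebra k M))).comp (emb k S)

lemma toFractionRing_injective (S : AddSubmonoid M) : Function.Injective (toFractionRing k S) :=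
  (IsFractionRing.injective _ _).comp (emb_injective k S)

lemma toFractionRing_comp_incl (hST : S ≤ T) :
    (toFractionRing k T).comp (incl k hST) = toFractionRing k S := by
  rw [RingHom.comp_assoc, emb_comp_incl]

end Injectivity

section Finiteness

variable (k : Type u) [Field k] {M : Type v} [AddCommGroup M] [Module.Free ℤ M] [Module.Finite ℤ M]
  {S T : AddSubmonoid M}

lemma incl_saturation_finite (hS : S.FG) : (incl k (le_saturationSubmonoid S)).Finite := by
  obtain ⟨B, hB, hBS, hSB⟩ := exists_finite_saturation_subset_add hS
  let := (incl k (le_saturationSubmonoid S)).toAlgebra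
  have hfin : ((fun b : saturationSubmonoid S => single b (1 : k)) ''
      (Subtype.val ⁻¹' B)).Finite :=
    (hB.preimage Subtype.val_injective.injOn).image _
  refine Module.finite_def.2 (Submodule.fg_def.2 ⟨_, hfin, eq_top_iff.2 fun f _ => ?_⟩)
  induction f using AddMonoidAlgebra.induction_linear with
  | zero => exact Submodule.zero_mem _
  | add f g hf hg => exact Submodule.add_mem _ (hf trivial) (hg trivial)
  | single m a =>
    obtain ⟨s, hs, b, hb, hsb⟩ := hSB m.2
    have h1 := Submodule.smul_mem _ (single (⟨s, hs⟩ : S) a) (Submodule.subset_span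
      (R := AddMonoidAlgebra k S) (Set.mem_image_of_mem
        (fun b : saturationSubmonoid S => single b (1 : k)) 
        (show (⟨b, hBS hb⟩ : saturationSubmonoid S) ∈ Subtype.val ⁻¹' B from hb)))
    rw [Algebra.smul_def] at h1
    change incl k (le_saturationSubmonoid S) _ * _ ∈ _ at h1
    rw [incl_single, single_mul_single, mul_one] at h1
    convert h1 using 2
    exact Subtype.ext hsb.symm

/-- If `T` lies between `S` and its saturation, then `k[T]` is finite over `k[S]`. -/
theorem incl_finite (hS : S.FG) (hST : S ≤ T) (hT : T ≤ saturationSubmonoid S) :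
    (incl k hST).Finite := by
  have : AddMonoid.FG S := (AddMonoid.fg_iff_addSubmonoid_fg S).2 hS
  have := AddMonoidAlgebra.finiteType_of_fg k S
  have : IsNoetherianRing (AddMonoidAlgebra k S) := Algebra.FiniteType.isNoetherianRing k _
  -- Over the Noetherian ring `k[S]`, the algebra `k[T]` is a submodule of the finite module given
  -- by the saturation.
  let := (incl k (le_saturationSubmonoid S)).toAlgebra
  let := (incl k hST).toAlgebra
  have : Module.Finite (AddMonoidAlgebra k S) (AddMonoidAlgebra k (saturationSubmonoid S)) :=
    incl_saturation_finite k hS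
  have hcomp : (incl k hT).comp (incl k hST) = incl k (le_saturationSubmonoid S) :=
    AddMonoidAlgebra.ringHom_ext
      (fun a => by rw [RingHom.comp_apply, incl_single, incl_single, incl_single])
      (fun a => by rw [RingHom.comp_apply, incl_single, incl_single, incl_single])
  let φ : AddMonoidAlgebra k T →ₐ[AddMonoidAlgebra k S] AddMonoidAlgebra k (saturationSubmonoid S) :=
    { incl k hT with commutes' := fun r => RingHom.congr_fun hcomp r }
  exact Module.Finite.of_injective φ.toLinearMap
    (incl_injective k hT)

end Finiteness

/-! ### Maximality at the level of rings -/

section Maximality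

variable {k : Type u} [Field k] [IsAlgClosed k] {M : Type v} [AddCommGroup M] [Module.Free ℤ M]
  [Module.Finite ℤ M] {S T : AddSubmonoid M}

/-- An integral `k[S]`-algebra with a homomorphism to the fraction field, such that homomorphisms
to the fraction field are determined by their restriction to `k[S]`, maps to `k[T]` if
`wn p S ⊆ T`. -/
theorem exists_ringHom_comp_eq_incl {p : ℕ} [CharP k p] (hS : S.FG) (hST : S ≤ T)
    (hT : wn p S ⊆ T) {C : Type*} [CommRing C] (φ : AddMonoidAlgebra k S →+* C)
    (hφ : φ.IsIntegral) (γ : C →+* FractionRing (AddMonoidAlgebra k M))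
    (hγ : γ.comp φ = toFractionRing k S)
    (huniq : ∀ α β : C →+* FractionRing (AddMonoidAlgebra k M), α.comp φ = β.comp φ → α = β) :
    ∃ h : C →+* AddMonoidAlgebra k T, h.comp φ = incl k hST := by
  obtain ⟨γ', hγ'⟩ := exists_ringHom_comp_eq (toFractionRing k (saturationSubmonoid S))
    (toFractionRing_injective k _) γ fun c => by
      refine exists_algebraMap_emb_eq_of_isIntegralElem k hS ?_
      change (toFractionRing k S).IsIntegralElem (γ c)
      obtain ⟨q, hq, hqc⟩ := hφ c
      exact ⟨q, hq, by rw [← hγ, ← Polynomial.hom_eval₂, hqc, map_zero]⟩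
  have hγ'φ : γ'.comp φ = incl k (le_saturationSubmonoid S) := by
    refine RingHom.ext fun x => toFractionRing_injective k (saturationSubmonoid S) ?_
    have h1 := RingHom.congr_fun hγ x
    rw [← hγ'] at h1
    exact h1.trans (RingHom.congr_fun (toFractionRing_comp_incl k (le_saturationSubmonoid S)) x).symm
  obtain ⟨h, hh⟩ := exists_ringHom_comp_eq (emb k T) (emb_injective k T)
    ((emb k (saturationSubmonoid S)).comp γ') fun c => by
      refine exists_emb_eq k _ fun m hm => hT ?_
      have hms : m ∈ saturationSubmonoid S := by
        by_contra hms
        refine hm (Finsupp.mapDomain_of_notMem_range _ _ ?_)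
        rintro ⟨s, rfl⟩
        exact hms s.2
      rw [RingHom.comp_apply, coeff_emb k (γ' c) ⟨m, hms⟩] at hm
      refine mem_wn_of_forall_ringHom_eq (γ' c) (fun α β hαβ => ?_) hm
      -- Homomorphisms that agree on `k[S]` also agree after pulling back to `C`, by uniqueness into
      -- the fraction field.
      have := huniq ((algebraMap _ _).comp (α.comp γ')) ((algebraMap _ _).comp (β.comp γ')) (by
        rw [RingHom.comp_assoc, RingHom.comp_assoc, RingHom.comp_assoc, RingHom.comp_assoc, hγ'φ,
          hαβ])
      exact IsFractionRing.injective _ _ (RingHom.congr_fun this c)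
  refine ⟨h, RingHom.ext fun x => emb_injective k T ?_⟩
  have h1 := RingHom.congr_fun hh (φ x)
  have h2 := RingHom.congr_fun hγ'φ x
  simp only [RingHom.comp_apply] at h1 h2
  rw [h2] at h1
  exact h1.trans ((RingHom.congr_fun (emb_comp_incl k (le_saturationSubmonoid S)) x).trans
    (RingHom.congr_fun (emb_comp_incl k hST) x).symm)

end Maximality

end WeakNormalization

namespace WeakNormalization

open CategoryTheory AlgebraicGeometry Limits

/-! ### Universal homeomorphisms and birational morphisms -/

section Schemes

lemma isUniversalHomeo_of_isIntegralHom {Y X : Scheme.{u}} (f : Y ⟶ X) [IsIntegralHom f]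
    [Surjective f] [UniversallyInjective f] : IsUniversalHomeo f := by
  intro X' Y' i₁ i₂ f' h
  have : IsIntegralHom f' := MorphismProperty.of_isPullback h.flip inferInstance
  have : Surjective f' := MorphismProperty.of_isPullback h.flip inferInstance
  have : UniversallyInjective f' := MorphismProperty.of_isPullback h.flip inferInstance
  exact isHomeomorph_iff_continuous_isClosedMap_bijective.2
    ⟨f'.continuous, f'.isClosedMap, f'.injective, f'.surjective⟩

lemma IsUniversalHomeo.universallyInjective {Y X : Scheme.{u}} {f : Y ⟶ X}
    (hf : IsUniversalHomeo f) : UniversallyInjective f := by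
  rw [universallyInjective_eq]
  exact fun _ _ _ _ _ h => (hf _ _ _ h).injective

lemma IsUniversalHomeo.universallyClosed {Y X : Scheme.{u}} {f : Y ⟶ X}
    (hf : IsUniversalHomeo f) : UniversallyClosed f := by
  rw [universallyClosed_eq]
  exact fun _ _ _ _ _ h => (hf _ _ _ h).isClosedMap

/-- A universally injective morphism is separated. -/
lemma isSeparated_of_universallyInjective {Y X : Scheme.{u}} (f : Y ⟶ X) [UniversallyInjective f] :
    IsSeparated f := by
  -- The diagonal is a preimmersion; being surjective, it has closed range and is a closed
  -- immersion.
  have : Surjective (pullback.diagonal f) := (UniversallyInjective.iff_diagonal f).1 inferInstance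
  refine ⟨.of_isPreimmersion _ ?_⟩
  rw [(pullback.diagonal f).surjective.range_eq]
  exact isClosed_univ

/-- A universal homeomorphism of finite type is finite. -/
theorem IsUniversalHomeo.isFinite {Y X : Scheme.{u}} {f : Y ⟶ X} (hf : IsUniversalHomeo f)
    [LocallyOfFiniteType f] : IsFinite f := by
  have := hf.universallyInjective
  have := hf.universallyClosed
  have := isSeparated_of_universallyInjective f
  have : IsProper f := {}
  exact .of_isProper_of_locallyQuasiFinite f

/-- A morphism whose image lies in every dense open subset lifts along birational morphisms. -/
lemma IsBirational.exists_lift {Z X W : Scheme.{u}} {g : Z ⟶ X} (hg : IsBirational g) (w : W ⟶ X)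
    (hw : ∀ U : X.Opens, Dense (U : Set X) → Set.range w ⊆ U) : ∃ γ : W ⟶ Z, γ ≫ g = w := by
  obtain ⟨U, V, e, hU, -, hiso⟩ := hg
  refine ⟨IsOpenImmersion.lift U.ι w (by simpa using hw U hU) ≫ inv (g.resLE U V e) ≫ V.ι, ?_⟩
  rw [Category.assoc, Category.assoc, ← Scheme.Hom.resLE_comp_ι g e, IsIso.inv_hom_id_assoc,
    IsOpenImmersion.lift_fac]

lemma isBirational_of_isOpenImmersion {Y X W : Scheme.{u}} {f : Y ⟶ X} (i : W ⟶ Y) (j : W ⟶ X)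
    [IsOpenImmersion i] [IsOpenImmersion j] (h : i ≫ f = j) (hi : Dense (Set.range i))
    (hj : Dense (Set.range j)) : IsBirational f := by
  have e : i.opensRange ≤ f ⁻¹ᵁ j.opensRange := by
    rintro _ ⟨x, rfl⟩
    exact ⟨x, by rw [← h]; rfl⟩
  refine ⟨j.opensRange, i.opensRange, e, hj, hi, ?_⟩
  have : i.isoOpensRange.hom ≫ f.resLE _ _ e = j.isoOpensRange.hom := by
    rw [← cancel_mono j.opensRange.ι, Category.assoc, Scheme.Hom.resLE_comp_ι,
      Scheme.Hom.isoOpensRange_hom_ι_assoc, h, Scheme.Hom.isoOpensRange_hom_ι]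
  rw [← Iso.eq_inv_comp] at this
  rw [this]
  infer_instance

/-- The generic point of the spectrum of a domain lies in every dense open subset. -/
lemma range_specMap_subset_of_injective {A K : Type u} [CommRing A] [Field K] (φ : A →+* K)
    (hφ : Function.Injective φ) (U : (Spec (CommRingCat.of A)).Opens)
    (hU : Dense (U : Set (Spec (CommRingCat.of A)))) :
    Set.range (Spec.map (CommRingCat.ofHom φ)) ⊆ U := by
  have : Nontrivial A := RingHom.domain_nontrivial φ
  rintro _ ⟨x, rfl⟩
  obtain ⟨y, hy⟩ := hU.nonempty
  -- The image point is the zero ideal, which specializes to every point and so lies in every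
  -- nonempty open set.
  have hle : (Spec.map (CommRingCat.ofHom φ) x).asIdeal ≤ y.asIdeal := by
    intro a ha
    have h1 : φ a ∈ x.asIdeal := ha
    have h2 : φ a = 0 := by
      by_contra h0
      exact x.2.ne_top (Ideal.eq_top_of_isUnit_mem _ h1 (isUnit_iff_ne_zero.2 h0))
    obtain rfl : a = 0 := hφ (h2.trans (map_zero φ).symm)
    exact y.asIdeal.zero_mem
  exact ((PrimeSpectrum.le_iff_specializes _ _).1 hle).mem_open U.2 hy

lemma universallyInjective_iff_forall_ringHom {A B : Type u} [CommRing A] [CommRing B]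
    (φ : A →+* B) : UniversallyInjective (Spec.map (CommRingCat.ofHom φ)) ↔
      ∀ (K : Type u) [Field K] (α β : B →+* K), α.comp φ = β.comp φ → α = β := by
  have htfae := (tfae_universallyInjective (Spec.map (CommRingCat.ofHom φ))).out 0 1
  refine htfae.trans ⟨fun h K _ α β hαβ => ?_, fun h K _ a b hab => ?_⟩
  · have := h K (a₁ := Spec.map (CommRingCat.ofHom α)) (a₂ := Spec.map (CommRingCat.ofHom β)) (by
      simp only [← Spec.map_comp, ← CommRingCat.ofHom_comp, hαβ])
    exact congrArg CommRingCat.Hom.hom (Spec.map_injective this)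
  · obtain ⟨α, rfl⟩ := Spec.map_surjective a
    obtain ⟨β, rfl⟩ := Spec.map_surjective b
    simp only [← Spec.map_comp] at hab
    have h1 := h K α.hom β.hom (congrArg CommRingCat.Hom.hom (Spec.map_injective hab))
    rw [CommRingCat.hom_ext h1]

end Schemes

/-! ### Geometry of `Spec k[T] ⟶ Spec k[S]` -/

section ToricVarieties

variable {k : Type u} [Field k] {M : Type v} [AddCommGroup M] {S T : AddSubmonoid M}

/-- The sum of the generators works: each generator is a summand of it. -/
lemma exists_forall_exists_nsmul_eq_add (hS : S.FG) :
    ∃ s ∈ S, ∀ b ∈ S, ∃ (n : ℕ), ∃ c ∈ S, n • s = b + c := by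
  classical
  obtain ⟨A, rfl⟩ := hS
  have hA (B : Finset M) (hB : B ⊆ A) : ∑ a ∈ B, a ∈ AddSubmonoid.closure (A : Set M) :=
    sum_mem fun a ha => AddSubmonoid.subset_closure (hB ha)
  refine ⟨∑ a ∈ A, a, hA A subset_rfl, fun b hb => ?_⟩
  induction hb using AddSubmonoid.closure_induction with
  | mem a ha =>
    exact ⟨1, _, hA _ (A.erase_subset a), by
      rw [one_smul]; exact (Finset.add_sum_erase A (fun a => a) ha).symm⟩
  | zero => exact ⟨0, 0, zero_mem _, by simp⟩
  | add x y _ _ hx hy =>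
    obtain ⟨n, c, hc, hx⟩ := hx
    obtain ⟨l, d, hd, hy⟩ := hy
    exact ⟨n + l, c + d, add_mem hc hd, by rw [add_smul, hx, hy]; abel⟩

/-- A finitely generated semigroup generating `M` becomes `M` after inverting a single element. -/
lemma exists_forall_exists_add_nsmul_mem (hS : S.FG) (hSM : (S : Set M) - (S : Set M) = Set.univ) :
    ∃ s ∈ S, ∀ m : M, ∃ n : ℕ, m + n • s ∈ S := by
  obtain ⟨s, hs, h⟩ := exists_forall_exists_nsmul_eq_add hS
  refine ⟨s, hs, fun m => ?_⟩
  obtain ⟨a, ha, b, hb, rfl⟩ : m ∈ (S : Set M) - (S : Set M) := hSM ▸ Set.mem_univ m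
  obtain ⟨n, c, hc, hn⟩ := h b hb
  refine ⟨n, ?_⟩
  rw [hn, show a - b + (b + c) = a + c by abel]
  exact add_mem ha hc

lemma isOpenImmersion_specMap_emb {s : M} (hs : s ∈ S) (h : ∀ m : M, ∃ n : ℕ, m + n • s ∈ S) :
    IsOpenImmersion (Spec.map (CommRingCat.ofHom (emb k S))) := by
  let := (AddMonoidAlgebra.mapDomainAlgHom k k S.subtype).toRingHom.toAlgebra
  have := isLocalization_away_single k S.subtype Subtype.val_injective ⟨s, hs⟩ fun m => by
    obtain ⟨n, hn⟩ := h m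
    exact ⟨n, ⟨_, hn⟩, rfl⟩
  exact IsOpenImmersion.of_isLocalization (AddMonoidAlgebra.single (⟨s, hs⟩ : S) (1 : k))

variable [Module.Free ℤ M]

lemma dense_range_specMap_emb [IsOpenImmersion (Spec.map (CommRingCat.ofHom (emb k S)))] :
    Dense (Set.range (Spec.map (CommRingCat.ofHom (emb k S)))) := by
  have : Nonempty (Spec (CommRingCat.of (AddMonoidAlgebra k M))) :=
    inferInstanceAs (Nonempty (PrimeSpectrum (AddMonoidAlgebra k M)))
  exact (Spec.map (CommRingCat.ofHom (emb k S))).isOpenEmbedding.isOpen_range.dense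
    (Set.range_nonempty _)

/-- Both spectra contain the torus `Spec k[M]` as a dense open subscheme, compatibly with the
morphism. -/
theorem isBirational_specMap (hS : S.FG) (hSM : (S : Set M) - (S : Set M) = Set.univ)
    (hST : S ≤ T) : IsBirational (specMap k hST) := by
  obtain ⟨s, hs, h⟩ := exists_forall_exists_add_nsmul_mem hS hSM
  have := isOpenImmersion_specMap_emb (k := k) hs h
  have := isOpenImmersion_specMap_emb (k := k) (hST hs) fun m => (h m).imp fun n hn => hST hn
  refine isBirational_of_isOpenImmersion (Spec.map (CommRingCat.ofHom (emb k T)))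
    (Spec.map (CommRingCat.ofHom (emb k S))) ?_ dense_range_specMap_emb dense_range_specMap_emb
  rw [← emb_comp_incl k hST, CommRingCat.ofHom_comp, Spec.map_comp]
  rfl

variable [Module.Finite ℤ M] {p : ℕ} [CharP k p]

theorem isBirationalUniversalHomeo_specMap (hS : S.FG)
    (hSM : (S : Set M) - (S : Set M) = Set.univ) (hST : S ≤ T) (hT : (T : Set M) ⊆ wn p S) :
    IsBirationalUniversalHomeo (specMap k hST) := by
  have hfin : (incl k hST).Finite := incl_finite k hS hST (hT.trans wn_subset_saturation)
  have : IsFinite (specMap k hST) := (IsFinite.SpecMap_iff _).2 hfin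
  have : UniversallyInjective (specMap k hST) :=
    (universallyInjective_iff_forall_ringHom (incl k hST)).2
      fun K _ α β h => ringHom_eq_of_comp_incl_eq (p := p) hS hST hT α β h
  have : Surjective (specMap k hST) :=
    ⟨hfin.to_isIntegral.comap_surjective (incl_injective k hST)⟩
  exact ⟨inferInstance, inferInstance, inferInstance, isUniversalHomeo_of_isIntegralHom _,
    isBirational_specMap hS hSM hST⟩

/-- Birational universal homeomorphisms are dominated by `Spec k[T]` if `wn p S ⊆ T`. -/
theorem existsUnique_comp_eq_specMap [IsAlgClosed k] (hS : S.FG) (hST : S ≤ T) (hT : wn p S ⊆ T)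
    {Z : Scheme.{max u v}} (g : Z ⟶ Spec (CommRingCat.of (AddMonoidAlgebra k S)))
    (hg : IsBirationalUniversalHomeo g) : ∃! h, h ≫ g = specMap k hST := by
  have := hg.locallyOfFiniteType
  have : IsFinite g := hg.isUniversalHomeo.isFinite
  have := hg.isUniversalHomeo.universallyInjective
  have : IsAffine Z := isAffine_of_isAffineHom g
  obtain ⟨φ, hφ⟩ := Spec.map_surjective (Z.isoSpec.inv ≫ g)
  have hint : φ.hom.IsIntegral := by
    rw [← IsIntegralHom.SpecMap_iff, hφ]
    infer_instance
  have huniq := (universallyInjective_iff_forall_ringHom φ.hom).1 (by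
    rw [CommRingCat.ofHom_hom, hφ]
    exact MorphismProperty.comp_mem _ _ _ inferInstance ‹UniversallyInjective g›)
  obtain ⟨γ, hγ⟩ := hg.isBirational.exists_lift (Spec.map (CommRingCat.ofHom (toFractionRing k S)))
    (range_specMap_subset_of_injective _ (toFractionRing_injective k S))
  obtain ⟨γ₀, hγ₀⟩ := Spec.map_surjective (γ ≫ Z.isoSpec.hom)
  have hγφ : γ₀.hom.comp φ.hom = toFractionRing k S := by
    have : Spec.map (φ ≫ γ₀) = Spec.map (CommRingCat.ofHom (toFractionRing k S)) := by
      rw [Spec.map_comp, hφ, hγ₀, ← hγ]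
      simp
    exact congrArg CommRingCat.Hom.hom (Spec.map_injective this)
  obtain ⟨h, hh⟩ := exists_ringHom_comp_eq_incl hS hST hT φ.hom hint γ₀.hom hγφ
    (huniq (FractionRing (AddMonoidAlgebra k M)))
  refine ⟨Spec.map (CommRingCat.ofHom h) ≫ Z.isoSpec.inv, ?_, fun h' hh' => ?_⟩
  · change (_ ≫ _) ≫ _ = _
    rw [Category.assoc, ← hφ, ← Spec.map_comp]
    exact congrArg (fun ψ => Spec.map (CommRingCat.ofHom ψ)) hh
  · rw [Iso.eq_comp_inv]
    obtain ⟨ψ, hψ⟩ := Spec.map_surjective (h' ≫ Z.isoSpec.hom)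
    rw [← hψ]
    congr 1
    apply CommRingCat.hom_ext
    have hψφ : ψ.hom.comp φ.hom = incl k hST := by
      have : Spec.map (φ ≫ ψ) = specMap k hST := by
        rw [Spec.map_comp, hφ, hψ, ← hh']
        simp
      exact congrArg CommRingCat.Hom.hom (Spec.map_injective this)
    -- Uniqueness also comes from universal injectivity, after embedding `k[T]` in a field.
    have := huniq _ ((toFractionRing k T).comp ψ.hom) ((toFractionRing k T).comp h)
      (congrArg (toFractionRing k T).comp (hψφ.trans hh.symm))
    exact RingHom.ext fun c => toFractionRing_injective k T (RingHom.congr_fun this c)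

end ToricVarieties

end WeakNormalization

theorem proposition2p4
    (k : Type u) [Field k] [IsAlgClosed k] (p : ℕ) [CharP k p]
    (M : Type v) [AddCommGroup M] [Module.Free ℤ M] [Module.Finite ℤ M]
    (S : AddSubmonoid M) (hfg : S.FG) (hS : (S : Set M) - (S : Set M) = Set.univ) :
    Set.PairwiseDisjoint
      {σ : PointedCone ℝ (ℝ ⊗[ℤ] M) | σ.IsFaceOf (WeakNormalization.cone S)}
      (WeakNormalization.wnPiece p S) ∧
    ∃ (T : AddSubmonoid M) (hST : S ≤ T), (T : Set M) = WeakNormalization.wn p S ∧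
      WeakNormalization.IsWeakNormalization (WeakNormalization.specMap k hST) := by
  refine ⟨WeakNormalization.pairwiseDisjoint_wnPiece k p S, WeakNormalization.wnSubmonoid k p S,
    fun s hs => WeakNormalization.subset_wn hs, rfl, ?_, fun Z g hg => ?_⟩
  · exact WeakNormalization.isBirationalUniversalHomeo_specMap (p := p) hfg hS _ subset_rfl
  · exact WeakNormalization.existsUnique_comp_eq_specMap (p := p) hfg _ subset_rfl g hg
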